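/- Let $G$ be a finite group. A \emph{transfer system} $\mathcal O$ for $G$ is a partial order $K\to H$ on the subgroups of $G$ which refines inclusion and is closed under conjugation and under restriction (if $K\to H$ and $L\le H$, then $K\cap L\to L$). Let $\mathcal A^{\mathcal O}$ be its Lindner category: objects are finite $G$-sets, morphisms $S\to T$ are isomorphism classes of spans $S\leftarrow U\xrightarrow{h}T$ of finite $G$-sets such that $\mathrm{Stab}(u)\to\mathrm{Stab}(h(u))$ is in $\mathcal O$ for all $u\in U$, and composition is by pullback. A \emph{rational $\mathcal O$-Mackey functor} is a product preserving functor from $\mathcal A^{\mathcal O}$ to rational vector spaces. Let $\underline A^{\mathcal O}_{\mathbb Q}$ be the rational $\mathcal O$-Burnside Mackey functor: $\underline A^{\mathcal O}_{\mathbb Q}(X)$ is $\mathbb Q$ tensored with the Grothendieck group of the monoid $\mathcal A^{\mathcal O}(G/G,X)$ under disjoint union (so $\underline A^{\mathcal O}_{\mathbb Q}(G/H)$ has the orbits $H/K$ with $K\to H$ in $\mathcal O$, up to isomorphism, as a basis). It is a commutative Green functor, that is, a commutative monoid for the Day convolution product of rational $\mathcal O$-Mackey functors, with multiplication induced by the product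 of $G$-sets. For a commutative Green functor $A$, an $A$-module is a rational $\mathcal O$-Mackey functor $M$ with an associative and unital action, given by natural bilinear maps $A(X)\times M(Y)\to M(X\times Y)$. For an idempotent $e\in A(G/G)$, $eA$ is the Green functor with $(eA)(X)=e\cdot A(X)$ and unit $e$, and $eM$ is the $eA$-module with $(eM)(X)=e\cdot M(X)$. Let $\mathrm{Sub}^{\mathcal O}(G)$ be the set of subgroups $H$ with $H\to G$ in $\mathcal O$, and $\mathrm{Sub}^{\mathcal O}(G)/G$ the set of its conjugacy classes $(H)$. For each such $(H)$ there is a unique element $e_{[H]}\in\underline A^{\mathcal O}_{\mathbb Q}(G/G)$ whose image under the linear extension of $T\mapsto(K\mapsto|T^K|)$, $K\in\mathrm{Sub}^{\mathcal O}(G)$, is the characteristic function of $(H)$, and $e_{[H]}$ is idempotent. With these elements: 1. Every rational $\mathcal O$-Mackey functor has a unique $\underline A^{\mathcal O}_{\mathbb Q}$-module structure, and the forgetful functor from $\underline A^{\mathcal O}_{\mathbb Q}$-modules to rational $\mathcal O$-Mackey functors is an equivalence of categories. 2. The functor $M\mapsto(e_{[H]}M)_{(H)}$ is an equivalence of categories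 $$\underline A^{\mathcal O}_{\mathbb Q}\text{-Mod}\;\simeq\prod_{(H)\in\mathrm{Sub}^{\mathcal O}(G)/G}e_{[H]}\underline A^{\mathcal O}_{\mathbb Q}\text{-Mod}.$$ The factors are orthogonal full subcategories: restriction of scalars along $\underline A^{\mathcal O}_{\mathbb Q}\to e_{[H]}\underline A^{\mathcal O}_{\mathbb Q}$ is fully faithful, and for $(H)\ne(K)$ the only map of $\underline A^{\mathcal O}_{\mathbb Q}$-modules from an $e_{[H]}\underline A^{\mathcal O}_{\mathbb Q}$-module to an $e_{[K]}\underline A^{\mathcal O}_{\mathbb Q}$-module is zero. 3. Every rational $\mathcal O$-Mackey functor $M$ is the direct sum of its pieces: $$M\cong\bigoplus_{(H)\in\mathrm{Sub}^{\mathcal O}(G)/G}e_{[H]}M,$$ where the inclusions $e_{[H]}M\to M$ exhibit $M$ as the coproduct, and the projections $m\mapsto e_{[H]}m$ exhibit $M$ as the product, of the $e_{[H]}M$ in the category of rational $\mathcal O$-Mackey functors. -/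

import Mathlib

open CategoryTheory Limits TensorProduct

universe u v w

namespace OMackey

/-! ### Transfer systems and finite `G`-sets -/

/-- A transfer system for `G`: a partial order `K → H` on the subgroups of `G` that refines
inclusion (so antisymmetry is automatic) and is closed under conjugation and restriction. -/
structure TransferSystem (G : Type u) [Group G] where
  Rel : Subgroup G → Subgroup G → Prop
  le_of_rel : ∀ {K H : Subgroup G}, Rel K H → K ≤ H
  refl : ∀ H : Subgroup G, Rel H H
  trans : ∀ {K H L : Subgroup G}, Rel K H → Rel H L → Rel K L
  conj : ∀ {K H : Subgroup G} (g : G), Rel K H →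
    Rel (K.map (MulAut.conj g).toMonoidHom) (H.map (MulAut.conj g).toMonoidHom)
  restrict : ∀ {K H L : Subgroup G}, Rel K H → L ≤ H → Rel (K ⊓ L) L

/-- A finite `G`-set. -/
structure FinGSet (G : Type u) [Group G] where
  carrier : Type u
  [action : MulAction G carrier]
  [finite : Finite carrier]

namespace FinGSet

variable {G : Type u} [Group G]

instance : CoeSort (FinGSet G) (Type u) := ⟨FinGSet.carrier⟩

attribute [instance] FinGSet.action FinGSet.finite

/-- The one-point `G`-set `G/G`. -/
abbrev pt : FinGSet G := ⟨PUnit.{u + 1}⟩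

/-- The product of two finite `G`-sets, with the diagonal action. -/
abbrev prod (X Y : FinGSet G) : FinGSet G := ⟨X × Y⟩

/-- The disjoint union of two finite `G`-sets. -/
abbrev sum (X Y : FinGSet G) : FinGSet G := ⟨X ⊕ Y⟩

/-- The empty `G`-set. -/
def empty : FinGSet G where
  carrier := PEmpty.{u + 1}
  action := { smul := fun _ x => x, one_smul := fun _ => rfl, mul_smul := fun _ _ _ => rfl }

/-- The pullback of two equivariant maps. -/
def pullback {X Y Z : FinGSet G} (f : X →[G] Z) (g : Y →[G] Z) : FinGSet G where
  carrier := {p : X × Y // f p.1 = g p.2}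
  action :=
    { smul := fun a p => ⟨(a • p.1.1, a • p.1.2), by simp [p.2]⟩
      one_smul := fun p => Subtype.ext (one_smul G p.1)
      mul_smul := fun a b p => Subtype.ext (mul_smul a b p.1) }

@[simp] lemma pullback_smul_fst {X Y Z : FinGSet G} {f : X →[G] Z} {g : Y →[G] Z} (a : G)
    (p : pullback f g) : (a • p).1.1 = a • p.1.1 := rfl

@[simp] lemma pullback_smul_snd {X Y Z : FinGSet G} {f : X →[G] Z} {g : Y →[G] Z} (a : G)
    (p : pullback f g) : (a • p).1.2 = a • p.1.2 := rfl

@[simp] lemma prod_smul_fst {X Y : FinGSet G} (a : G) (p : prod X Y) :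
    (a • p).1 = a • p.1 := rfl

@[simp] lemma prod_smul_snd {X Y : FinGSet G} (a : G) (p : prod X Y) :
    (a • p).2 = a • p.2 := rfl

@[simp] lemma sum_smul_inl {X Y : FinGSet G} (a : G) (x : X) :
    (a • (show sum X Y from Sum.inl x) : sum X Y) = (Sum.inl (a • x) : X ⊕ Y) := rfl

@[simp] lemma sum_smul_inr {X Y : FinGSet G} (a : G) (x : Y) :
    (a • (show sum X Y from Sum.inr x) : sum X Y) = (Sum.inr (a • x) : X ⊕ Y) := rfl

end FinGSet

namespace TransferSystem

variable {G : Type u} [Group G] (O : TransferSystem G)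

/-- The maps `f : S → T` of finite `G`-sets in the indexing category of `O`: those with
`Stab(s) → Stab(f(s))` in `O` for all `s`. -/
def Admissible {S T : FinGSet G} (f : S →[G] T) : Prop :=
  ∀ s : S, O.Rel (MulAction.stabilizer G s) (MulAction.stabilizer G (f s))

lemma admissible_of_injective {S T : FinGSet G} (f : S →[G] T) (hf : Function.Injective f) :
    O.Admissible f := by
  intro s
  have : MulAction.stabilizer G (f s) = MulAction.stabilizer G s := by
    ext g
    simp only [MulAction.mem_stabilizer_iff, ← map_smul]
    exact hf.eq_iff
  rw [this]
  exact O.refl _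

lemma rel_inf {K H K' H' : Subgroup G} (h : O.Rel K H) (h' : O.Rel K' H') :
    O.Rel (K ⊓ K') (H ⊓ H') := by
  have h1 : O.Rel (K ⊓ K') (H ⊓ K') := by
    have := O.restrict (L := H ⊓ K') h inf_le_left
    rwa [← inf_assoc, inf_eq_left.mpr (O.le_of_rel h)] at this
  have h2 : O.Rel (H ⊓ K') (H ⊓ H') := by
    have := O.restrict (L := H ⊓ H') h' inf_le_right
    rwa [inf_left_comm, inf_eq_left.mpr (O.le_of_rel h')] at this
  exact O.trans h1 h2

end TransferSystem

/-! ### The Lindner category -/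

/-- A span `S ← U → T` of finite `G`-sets whose right leg is in the indexing category of `O`. -/
structure GSpan {G : Type u} [Group G] (O : TransferSystem G) (S T : FinGSet G) where
  apex : FinGSet G
  left : apex →[G] S
  right : apex →[G] T
  adm : O.Admissible right

namespace GSpan

variable {G : Type u} [Group G] {O : TransferSystem G}

/-- Two spans are isomorphic if there is an equivariant bijection of the apices that is compatible
with both legs. -/
def Iso {S T : FinGSet G} (s t : GSpan O S T) : Prop :=
  ∃ e : s.apex ≃ t.apex, (∀ (g : G) (x : s.apex), e (g • x) = g • e x) ∧
    (∀ x, t.left (e x) = s.left x) ∧ (∀ x, t.right (e x) = s.right x)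

lemma Iso.refl {S T : FinGSet G} (s : GSpan O S T) : Iso s s :=
  ⟨Equiv.refl _, fun _ _ => rfl, fun _ => rfl, fun _ => rfl⟩

instance setoid (S T : FinGSet G) : Setoid (GSpan O S T) where
  r := Iso
  iseqv :=
    { refl := Iso.refl
      symm := by
        rintro s t ⟨e, h1, h2, h3⟩
        refine ⟨e.symm, fun g x => ?_, fun x => ?_, fun x => ?_⟩
        · rw [Equiv.symm_apply_eq, h1, Equiv.apply_symm_apply]
        · rw [← h2, Equiv.apply_symm_apply]
        · rw [← h3, Equiv.apply_symm_apply]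
      trans := by
        rintro s t r ⟨e, h1, h2, h3⟩ ⟨e', h1', h2', h3'⟩
        exact ⟨e.trans e', fun g x => by simp [h1, h1'], fun x => by simp [h2, h2'],
          fun x => by simp [h3, h3']⟩ }

/-- The identity span. -/
def id (S : FinGSet G) : GSpan O S S :=
  ⟨S, MulActionHom.id G, MulActionHom.id G, fun _ => O.refl _⟩

/-- Composition of spans, by pullback. -/
def comp {R S T : FinGSet G} (s : GSpan O R S) (t : GSpan O S T) : GSpan O R T where
  apex := FinGSet.pullback s.right t.left
  left := { toFun := fun p => s.left p.1.1, map_smul' := fun g p => by simp }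
  right := { toFun := fun p => t.right p.1.2, map_smul' := fun g p => by simp }
  adm := by
    intro p
    have hp : MulAction.stabilizer G p =
        MulAction.stabilizer G p.1.1 ⊓ MulAction.stabilizer G p.1.2 := by
      ext g
      simp only [Subgroup.mem_inf, MulAction.mem_stabilizer_iff]
      exact Subtype.ext_iff.trans Prod.ext_iff
    rw [hp]
    refine O.trans (O.restrict (s.adm p.1.1) ?_) (t.adm p.1.2)
    rw [p.2]
    intro g hg
    rw [MulAction.mem_stabilizer_iff] at hg ⊢
    rw [← map_smul, hg]

/-- The disjoint union of two spans. -/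
def add {S T : FinGSet G} (s t : GSpan O S T) : GSpan O S T where
  apex := FinGSet.sum s.apex t.apex
  left :=
    { toFun := fun p => Sum.elim s.left t.left p
      map_smul' := fun g p => by rcases p with p | p <;> simp }
  right :=
    { toFun := fun p => Sum.elim s.right t.right p
      map_smul' := fun g p => by rcases p with p | p <;> simp }
  adm := by
    rintro (p | p)
    · refine O.trans ?_ (s.adm p)
      convert O.refl (MulAction.stabilizer G p) using 1
      ext g
      exact Sum.inl_injective.eq_iff
    · refine O.trans ?_ (t.adm p)
      convert O.refl (MulAction.stabilizer G p) using 1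
      ext g
      exact Sum.inr_injective.eq_iff

/-- The empty span. -/
def zero (S T : FinGSet G) : GSpan O S T where
  apex := FinGSet.empty
  left := { toFun := fun p => PEmpty.elim p, map_smul' := fun _ p => PEmpty.elim p }
  right := { toFun := fun p => PEmpty.elim p, map_smul' := fun _ p => PEmpty.elim p }
  adm := fun p => PEmpty.elim p

/-- The product of two spans. -/
def prod {S T S' T' : FinGSet G} (s : GSpan O S T) (t : GSpan O S' T') :
    GSpan O (S.prod S') (T.prod T') where
  apex := s.apex.prod t.apex
  left :=
    { toFun := fun p => (s.left p.1, t.left p.2)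
      map_smul' := fun g p => by ext <;> simp }
  right :=
    { toFun := fun p => (s.right p.1, t.right p.2)
      map_smul' := fun g p => by ext <;> simp }
  adm := by
    intro p
    have hp (X Y : FinGSet G) (q : X.prod Y) : MulAction.stabilizer G q =
        MulAction.stabilizer G q.1 ⊓ MulAction.stabilizer G q.2 := by
      ext g
      simp only [Subgroup.mem_inf, MulAction.mem_stabilizer_iff]
      exact Prod.ext_iff
    rw [hp, hp]
    exact O.rel_inf (s.adm _) (t.adm _)

/-- The span `S = S → T` given by an injective equivariant map. -/
def ofInj {S T : FinGSet G} (f : S →[G] T) (hf : Function.Injective f) : GSpan O S T :=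
  ⟨S, MulActionHom.id G, f, O.admissible_of_injective f hf⟩

end GSpan

/-- The Lindner category of `O`: objects are finite `G`-sets, morphisms are isomorphism classes of
spans `S ← U → T` with right leg in the indexing category of `O`, composed by pullback. -/
structure Lindner {G : Type u} [Group G] (O : TransferSystem G) where of ::
  set : FinGSet G

namespace Lindner

variable {G : Type u} [Group G] {O : TransferSystem G}

/-- Morphisms of the Lindner category. -/
def Hom (S T : Lindner O) : Type (u + 1) := Quotient (GSpan.setoid (O := O) S.set T.set)

/-- The morphism represented by a span. -/
def Hom.mk {S T : Lindner O} (s : GSpan O S.set T.set) : Hom S T := Quotient.mk _ s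

lemma Hom.ind {S T : Lindner O} {p : Hom S T → Prop} (h : ∀ s, p (Hom.mk s)) (f : Hom S T) : p f :=
  Quotient.ind h f

lemma Hom.sound {S T : Lindner O} {s t : GSpan O S.set T.set} (h : GSpan.Iso s t) :
    Hom.mk s = Hom.mk t := Quotient.sound h

/-- Composition of isomorphism classes of spans. -/
def Hom.comp {R S T : Lindner O} : Hom R S → Hom S T → Hom R T :=
  Quotient.map₂ GSpan.comp (by
    rintro s s' ⟨e, h1, h2, h3⟩ t t' ⟨e', h1', h2', h3'⟩
    refine ⟨⟨fun p => ⟨(e p.1.1, e' p.1.2), ?_⟩, fun p => ⟨(e.symm p.1.1, e'.symm p.1.2), ?_⟩,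
      fun p => ?_, fun p => ?_⟩, fun g p => ?_, fun p => ?_, fun p => ?_⟩
    · rw [h3, h2']; exact p.2
    · rw [← h3, ← h2', Equiv.apply_symm_apply, Equiv.apply_symm_apply]; exact p.2
    · exact Subtype.ext (Prod.ext (e.symm_apply_apply _) (e'.symm_apply_apply _))
    · exact Subtype.ext (Prod.ext (e.apply_symm_apply _) (e'.apply_symm_apply _))
    · exact Subtype.ext (Prod.ext (h1 _ _) (h1' _ _))
    · exact h2 _
    · exact h3' _)

instance : Category.{u + 1} (Lindner O) where
  Hom := Hom
  id S := Hom.mk (GSpan.id S.set)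
  comp := Hom.comp
  id_comp := by
    intro S T f
    induction f using Hom.ind with
    | h s =>
      refine Hom.sound ⟨⟨fun p => p.1.2, fun x => ⟨(s.left x, x), rfl⟩, fun p => ?_, fun x => rfl⟩,
        fun g p => rfl, fun p => ?_, fun p => rfl⟩
      · exact Subtype.ext (Prod.ext p.2.symm rfl)
      · exact p.2.symm
  comp_id := by
    intro S T f
    induction f using Hom.ind with
    | h s =>
      refine Hom.sound ⟨⟨fun p => p.1.1, fun x => ⟨(x, s.right x), rfl⟩, fun p => ?_, fun x => rfl⟩,
        fun g p => rfl, fun p => rfl, fun p => ?_⟩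
      · exact Subtype.ext (Prod.ext rfl p.2)
      · exact p.2
  assoc := by
    intro Q R S T f g h
    induction f using Hom.ind with
    | h r =>
    induction g using Hom.ind with
    | h s =>
    induction h using Hom.ind with
    | h t =>
      exact Hom.sound ⟨⟨fun p => ⟨(p.1.1.1.1, ⟨(p.1.1.1.2, p.1.2), p.2⟩), p.1.1.2⟩,
          fun p => ⟨(⟨(p.1.1, p.1.2.1.1), p.2⟩, p.1.2.1.2), p.1.2.2⟩,
          fun p => rfl, fun p => rfl⟩,
        fun g p => rfl, fun p => rfl, fun p => rfl⟩

/-- The morphism of the Lindner category represented by a span. -/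
def mk {S T : Lindner O} (s : GSpan O S.set T.set) : S ⟶ T := Hom.mk s

lemma ind {S T : Lindner O} {p : (S ⟶ T) → Prop} (h : ∀ s, p (mk s)) (f : S ⟶ T) : p f :=
  Quotient.ind h f

lemma sound {S T : Lindner O} {s t : GSpan O S.set T.set} (h : GSpan.Iso s t) :
    mk s = mk t := Quotient.sound h

lemma mk_comp_mk {R S T : Lindner O} (s : GSpan O R.set S.set) (t : GSpan O S.set T.set) :
    mk s ≫ mk t = mk (s.comp t) := rfl

lemma id_eq (S : Lindner O) : 𝟙 S = mk (GSpan.id S.set) := rfl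

/-- The object `G/G`. -/
def pt : Lindner O := ⟨FinGSet.pt⟩

/-- The product `X × Y` of finite `G`-sets (this is the tensor product of the Lindner category, not
its categorical product, which is the disjoint union). -/
def tens (X Y : Lindner O) : Lindner O := ⟨X.set.prod Y.set⟩

/-- The product of morphisms. -/
def tensMap {S T S' T' : Lindner O} : (S ⟶ T) → (S' ⟶ T') → (S.tens S' ⟶ T.tens T') :=
  Quotient.map₂ GSpan.prod (by
    rintro s s' ⟨e, h1, h2, h3⟩ t t' ⟨e', h1', h2', h3'⟩
    refine ⟨Equiv.prodCongr e e', fun g p => ?_, fun p => ?_, fun p => ?_⟩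
    · exact Prod.ext (h1 _ _) (h1' _ _)
    · exact Prod.ext (h2 _) (h2' _)
    · exact Prod.ext (h3 _) (h3' _))

lemma tensMap_mk {S T S' T' : Lindner O} (s : GSpan O S.set T.set) (t : GSpan O S'.set T'.set) :
    tensMap (mk s) (mk t) = mk (T := T.tens T') (S := S.tens S') (s.prod t) := rfl

/-- The associativity isomorphism `(X × Y) × Z ⟶ X × (Y × Z)`. -/
def assoc (X Y Z : Lindner O) : (X.tens Y).tens Z ⟶ X.tens (Y.tens Z) :=
  mk (S := (X.tens Y).tens Z) (T := X.tens (Y.tens Z)) (GSpan.ofInj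
    { toFun := fun p => (p.1.1, (p.1.2, p.2)), map_smul' := fun _ _ => rfl }
    (fun p q h => Prod.ext (Prod.ext (congrArg (fun t => t.1) h) (congrArg (fun t => t.2.1) h))
      (congrArg (fun t => t.2.2) h)))

/-- The unit isomorphism `G/G × X ⟶ X`. -/
def lunit (X : Lindner O) : pt.tens X ⟶ X :=
  mk (S := pt.tens X) (T := X) (GSpan.ofInj
    { toFun := fun p => p.2, map_smul' := fun _ _ => rfl } (fun _ _ h => Prod.ext rfl h))

/-- The symmetry isomorphism `X × Y ⟶ Y × X`. -/
def swap (X Y : Lindner O) : X.tens Y ⟶ Y.tens X :=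
  mk (S := X.tens Y) (T := Y.tens X) (GSpan.ofInj
    { toFun := fun p => (p.2, p.1), map_smul' := fun _ _ => rfl }
    (fun p q h => Prod.ext (congrArg (fun t => t.2) h) (congrArg (fun t => t.1) h)))

/-! Coherence facts. -/

lemma lunit_natural {X Y : Lindner O} (f : X ⟶ Y) :
    tensMap (𝟙 pt) f ≫ lunit Y = lunit X ≫ f := by
  induction f using ind with
  | h s =>
    refine sound ⟨⟨fun p => ⟨((p.1.1.1, s.left p.1.1.2), p.1.1.2), rfl⟩,
      fun p => ⟨((p.1.1.1, p.1.2), (p.1.1.1, s.right p.1.2)), rfl⟩, fun p => ?_, fun p => ?_⟩,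
      fun g p => ?_, fun p => rfl, fun p => ?_⟩
    · exact Subtype.ext (Prod.ext rfl p.2)
    · exact Subtype.ext (Prod.ext (Prod.ext rfl p.2.symm) rfl)
    · refine Subtype.ext (Prod.ext (Prod.ext rfl ?_) rfl)
      exact map_smul s.left _ _
    · exact congrArg Prod.snd p.2

lemma assoc_lunit (X Y : Lindner O) :
    assoc pt X Y ≫ lunit (X.tens Y) = tensMap (lunit X) (𝟙 Y) :=
  sound ⟨⟨fun p => p.1.1, fun p => ⟨(p, (p.1.1, (p.1.2, p.2))), rfl⟩,
      fun p => Subtype.ext (Prod.ext rfl p.2), fun p => rfl⟩,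
    fun g p => rfl, fun p => rfl, fun p => congrArg Prod.snd p.2⟩

lemma assoc_swap_lunit (X Y : Lindner O) :
    assoc X pt Y ≫ tensMap (𝟙 X) (lunit Y) = tensMap (swap X pt ≫ lunit X) (𝟙 Y) := by
  refine sound ⟨⟨fun p => (⟨(p.1.1.1, (p.1.1.1.2, p.1.1.1.1)), rfl⟩, p.1.1.2),
      fun p => ⟨(((p.1.1.1.1, p.1.1.1.2), p.2), (p.1.1.1.1, (p.1.1.1.2, p.2))), rfl⟩,
      fun p => ?_, fun p => ?_⟩,
    fun g p => rfl, fun p => rfl, fun p => ?_⟩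
  · exact Subtype.ext (Prod.ext rfl p.2)
  · exact Prod.ext (Subtype.ext (Prod.ext rfl p.1.2)) rfl
  · exact congrArg (fun t => (t.1, t.2.2)) p.2

lemma swap_lunit_pt : swap pt pt ≫ lunit (pt : Lindner O) = lunit pt :=
  sound ⟨⟨fun p => p.1.1, fun p => ⟨(p, (p.2, p.1)), rfl⟩,
      fun p => Subtype.ext (Prod.ext rfl p.2), fun p => rfl⟩,
    fun g p => rfl, fun p => rfl, fun p => rfl⟩

/-! Addition of morphisms: disjoint union of spans. -/

/-- The disjoint union of isomorphism classes of spans. -/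
def addHom {S T : Lindner O} : (S ⟶ T) → (S ⟶ T) → (S ⟶ T) :=
  Quotient.map₂ GSpan.add (by
    rintro s s' ⟨e, h1, h2, h3⟩ t t' ⟨e', h1', h2', h3'⟩
    refine ⟨Equiv.sumCongr e e', ?_, ?_, ?_⟩
    · rintro g (p | p)
      · exact congrArg Sum.inl (h1 _ _)
      · exact congrArg Sum.inr (h1' _ _)
    · rintro (p | p)
      · exact h2 _
      · exact h2' _
    · rintro (p | p)
      · exact h3 _
      · exact h3' _)

instance {S T : Lindner O} : Add (S ⟶ T) := ⟨addHom⟩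

instance {S T : Lindner O} : Zero (S ⟶ T) := ⟨mk (GSpan.zero S.set T.set)⟩

lemma mk_add_mk {S T : Lindner O} (s t : GSpan O S.set T.set) : mk s + mk t = mk (s.add t) := rfl

lemma zero_eq {S T : Lindner O} : (0 : S ⟶ T) = mk (GSpan.zero S.set T.set) := rfl

private lemma add_comm_aux {S T : Lindner O} (f g : S ⟶ T) : f + g = g + f := by
  induction f using ind with
  | h s =>
  induction g using ind with
  | h t =>
    refine sound ⟨Equiv.sumComm _ _, ?_, ?_, ?_⟩
    · rintro g (p | p) <;> rfl
    · rintro (p | p) <;> rfl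
    · rintro (p | p) <;> rfl

private lemma zero_add_aux {S T : Lindner O} (f : S ⟶ T) : 0 + f = f := by
  induction f using ind with
  | h s =>
    refine sound ⟨Equiv.emptySum PEmpty s.apex, ?_, ?_, ?_⟩
    · rintro g (p | p)
      · exact PEmpty.elim p
      · rfl
    · rintro (p | p)
      · exact PEmpty.elim p
      · rfl
    · rintro (p | p)
      · exact PEmpty.elim p
      · rfl

instance {S T : Lindner O} : AddCommMonoid (S ⟶ T) where
  add_assoc f g h := by
    induction f using ind with
    | h r =>
    induction g using ind with
    | h s =>
    induction h using ind with
    | h t =>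
      refine sound ⟨Equiv.sumAssoc _ _ _, ?_, ?_, ?_⟩
      · rintro g ((p | p) | p) <;> rfl
      · rintro ((p | p) | p) <;> rfl
      · rintro ((p | p) | p) <;> rfl
  zero_add := zero_add_aux
  add_zero f := (add_comm_aux f 0).trans (zero_add_aux f)
  add_comm := add_comm_aux
  nsmul := nsmulRec

lemma add_comp {R S T : Lindner O} (f f' : R ⟶ S) (g : S ⟶ T) :
    (f + f') ≫ g = f ≫ g + f' ≫ g := by
  induction f using ind with
  | h s =>
  induction f' using ind with
  | h s' =>
  induction g using ind with
  | h t =>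
    refine (sound ⟨⟨?_, ?_, ?_, ?_⟩, ?_, ?_, ?_⟩).symm
    · exact Sum.elim (fun p => ⟨(Sum.inl p.1.1, p.1.2), p.2⟩)
        (fun p => ⟨(Sum.inr p.1.1, p.1.2), p.2⟩)
    · rintro ⟨⟨p | p, q⟩, h⟩
      · exact Sum.inl ⟨(p, q), h⟩
      · exact Sum.inr ⟨(p, q), h⟩
    · rintro (p | p) <;> rfl
    · rintro ⟨⟨p | p, q⟩, h⟩ <;> rfl
    · rintro g (p | p) <;> rfl
    · rintro (p | p) <;> rfl
    · rintro (p | p) <;> rfl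

lemma comp_add {R S T : Lindner O} (f : R ⟶ S) (g g' : S ⟶ T) :
    f ≫ (g + g') = f ≫ g + f ≫ g' := by
  induction f using ind with
  | h s =>
  induction g using ind with
  | h t =>
  induction g' using ind with
  | h t' =>
    refine (sound ⟨⟨?_, ?_, ?_, ?_⟩, ?_, ?_, ?_⟩).symm
    · exact Sum.elim (fun p => ⟨(p.1.1, Sum.inl p.1.2), p.2⟩)
        (fun p => ⟨(p.1.1, Sum.inr p.1.2), p.2⟩)
    · rintro ⟨⟨p, q | q⟩, h⟩
      · exact Sum.inl ⟨(p, q), h⟩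
      · exact Sum.inr ⟨(p, q), h⟩
    · rintro (p | p) <;> rfl
    · rintro ⟨⟨p, q | q⟩, h⟩ <;> rfl
    · rintro g (p | p) <;> rfl
    · rintro (p | p) <;> rfl
    · rintro (p | p) <;> rfl

lemma zero_comp {R S T : Lindner O} (g : S ⟶ T) : (0 : R ⟶ S) ≫ g = 0 := by
  induction g using ind with
  | h t =>
    refine sound ⟨⟨fun p => PEmpty.elim p.1.1, fun p => PEmpty.elim p, fun p => PEmpty.elim p.1.1,
      fun p => PEmpty.elim p⟩, fun g p => PEmpty.elim p.1.1, fun p => PEmpty.elim p.1.1,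
      fun p => PEmpty.elim p.1.1⟩

lemma comp_zero {R S T : Lindner O} (f : R ⟶ S) : f ≫ (0 : S ⟶ T) = 0 := by
  induction f using ind with
  | h t =>
    refine sound ⟨⟨fun p => PEmpty.elim p.1.2, fun p => PEmpty.elim p, fun p => PEmpty.elim p.1.2,
      fun p => PEmpty.elim p⟩, fun g p => PEmpty.elim p.1.2, fun p => PEmpty.elim p.1.2,
      fun p => PEmpty.elim p.1.2⟩

lemma sum_comp {R S T : Lindner O} {ι : Type*} (s : Finset ι) (f : ι → (R ⟶ S)) (g : S ⟶ T) :
    (∑ i ∈ s, f i) ≫ g = ∑ i ∈ s, f i ≫ g :=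
  map_sum (⟨⟨fun f => f ≫ g, zero_comp g⟩, fun f f' => add_comp f f' g⟩ : (R ⟶ S) →+ (R ⟶ T)) f s

end Lindner

/-! ### Rational Mackey functors -/

section Mackey

variable {G : Type u} [Group G] {O : TransferSystem G}

/-- A functor out of the Lindner category that is additive on morphisms preserves finite
products. -/
lemma preservesFiniteProducts_of_additive (F : Lindner O ⥤ ModuleCat.{w} ℚ)
    (hadd : ∀ {X Y : Lindner O} (f g : X ⟶ Y), F.map (f + g) = F.map f + F.map g)
    (hzero : ∀ X Y : Lindner O, F.map (0 : X ⟶ Y) = 0) : PreservesFiniteProducts F := by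
  have hsum {X Y : Lindner O} {ι : Type} (s : Finset ι) (f : ι → (X ⟶ Y)) :
      F.map (∑ i ∈ s, f i) = ∑ i ∈ s, F.map (f i) :=
    map_sum (⟨⟨fun f => F.map f, hzero X Y⟩, hadd⟩ : (X ⟶ Y) →+ (F.obj X ⟶ F.obj Y)) f s
  refine ⟨fun n => ⟨fun {K} => ⟨fun {c} hc => ⟨?_⟩⟩⟩⟩
  classical
  let inc (j : Fin n) : K.obj ⟨j⟩ ⟶ c.pt := hc.lift
    { pt := K.obj ⟨j⟩
      π := Discrete.natTrans (fun i => if h : (⟨j⟩ : Discrete (Fin n)) = i then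
        eqToHom (by subst h; rfl) else 0) }
  have hinc (j : Fin n) (i : Discrete (Fin n)) : inc j ≫ c.π.app i =
      if h : (⟨j⟩ : Discrete (Fin n)) = i then eqToHom (by rw [h]) else 0 := by
    simp only [inc, hc.fac]
    rfl
  have hone : ∑ j : Fin n, c.π.app ⟨j⟩ ≫ inc j = 𝟙 c.pt := by
    refine hc.hom_ext fun i => ?_
    rw [Lindner.sum_comp, Category.id_comp]
    rw [Finset.sum_eq_single i.as]
    · rw [Category.assoc, hinc]
      simp
    · intro j _ hj
      rw [Category.assoc, hinc, dif_neg, Lindner.comp_zero]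
      rintro rfl
      exact hj rfl
    · simp
  refine
    { lift := fun s => ∑ j : Fin n, s.π.app ⟨j⟩ ≫ F.map (inc j)
      fac := fun s i => ?_
      uniq := fun s m hm => ?_ }
  · rw [Preadditive.sum_comp, Finset.sum_eq_single i.as]
    · simp only [Functor.mapCone_π_app, Category.assoc, ← F.map_comp, hinc]
      simp
    · intro j _ hj
      simp only [Functor.mapCone_π_app, Category.assoc, ← F.map_comp, hinc]
      rw [dif_neg, hzero, Limits.comp_zero]
      rintro rfl
      exact hj rfl
    · simp
  · have h := congrArg F.map hone
    rw [hsum, F.map_id] at h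
    calc m = m ≫ 𝟙 _ := (Category.comp_id m).symm
      _ = m ≫ ∑ j : Fin n, F.map (c.π.app ⟨j⟩ ≫ inc j) := by rw [h]; rfl
      _ = _ := by
        rw [Preadditive.comp_sum]
        refine Finset.sum_congr rfl fun j _ => ?_
        rw [F.map_comp, ← Category.assoc, ← hm ⟨j⟩]
        rfl

/-- A retract of a functor that preserves finite products preserves finite products. -/
lemma preservesFiniteProducts_of_retract {F F' : Lindner O ⥤ ModuleCat.{w} ℚ}
    (i : F' ⟶ F) (r : F ⟶ F') (hir : i ≫ r = 𝟙 F') (h : PreservesFiniteProducts F) :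
    PreservesFiniteProducts F' := by
  have hir' (X : Lindner O) : i.app X ≫ r.app X = 𝟙 _ := by
    rw [← NatTrans.comp_app, hir]; rfl
  refine ⟨fun n => ⟨fun {K} => ⟨fun {c} hc => ⟨?_⟩⟩⟩⟩
  have := h.preserves n
  let l := isLimitOfPreserves F hc
  let s' (s : Cone (K ⋙ F')) : Cone (K ⋙ F) :=
    { pt := s.pt
      π := s.π ≫ Functor.whiskerLeft K i }
  refine
    { lift := fun s => l.lift (s' s) ≫ r.app c.pt
      fac := fun s j => ?_
      uniq := fun s m hm => ?_ }
  · have := l.fac (s' s) j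
    simp only [Functor.mapCone_π_app] at this ⊢
    rw [Category.assoc, ← r.naturality, ← Category.assoc, this]
    simp only [s', NatTrans.comp_app, Functor.whiskerLeft_app, Category.assoc]
    erw [hir', Category.comp_id]
  · have := l.uniq (s' s) (m ≫ i.app c.pt) (fun j => by
      have := hm j
      simp only [Functor.mapCone_π_app, s', NatTrans.comp_app, Functor.whiskerLeft_app] at this ⊢
      rw [Category.assoc, ← i.naturality, ← Category.assoc, this])
    rw [← this, Category.assoc, hir']
    exact (Category.comp_id m).symm

variable (O) in
/-- The category of rational `O`-Mackey functors: product preserving functors from the Lindner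
category of `O` to rational vector spaces, with natural transformations as morphisms. -/
abbrev RatMackey : Type _ :=
  ObjectProperty.FullSubcategory
    (fun F : Lindner O ⥤ ModuleCat.{v} ℚ => PreservesFiniteProducts F)

end Mackey

/-! ### Green functors and their modules -/

open Lindner

/-- A commutative rational `O`-Green functor: a commutative monoid for the Day convolution (box)
product of rational `O`-Mackey functors. By the universal property of Day convolution a
multiplication `A □ A → A` is a family of bilinear maps `A(X) × A(Y) → A(X × Y)`, natural in
`X` and `Y` in the Lindner category, and a unit map from the unit object is an element of
`A(G/G)`. -/
structure GreenFunctor {G : Type u} [Group G] (O : TransferSystem G) where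
  functor : Lindner O ⥤ ModuleCat.{w} ℚ
  isMackey : PreservesFiniteProducts functor
  one : functor.obj pt
  mul : ∀ X Y : Lindner O,
    functor.obj X →ₗ[ℚ] functor.obj Y →ₗ[ℚ] functor.obj (X.tens Y)
  mul_natural : ∀ {X X' Y Y' : Lindner O} (f : X ⟶ X') (g : Y ⟶ Y')
    (a : functor.obj X) (b : functor.obj Y),
    mul X' Y' (functor.map f a) (functor.map g b) = functor.map (tensMap f g) (mul X Y a b)
  mul_assoc : ∀ {X Y Z : Lindner O} (a : functor.obj X) (b : functor.obj Y) (c : functor.obj Z),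
    functor.map (assoc X Y Z) (mul (X.tens Y) Z (mul X Y a b) c) =
      mul X (Y.tens Z) a (mul Y Z b c)
  one_mul : ∀ {X : Lindner O} (a : functor.obj X),
    functor.map (lunit X) (mul pt X one a) = a
  mul_comm : ∀ {X Y : Lindner O} (a : functor.obj X) (b : functor.obj Y),
    functor.map (swap X Y) (mul X Y a b) = mul Y X b a

/-- An action of a Green functor `A` on a functor `M`, that is, an associative and unital map
`A □ M → M`. -/
structure GreenAction {G : Type u} [Group G] {O : TransferSystem G} (A : GreenFunctor.{u, w} O)
    (M : Lindner O ⥤ ModuleCat.{v} ℚ) where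
  smul : ∀ X Y : Lindner O, A.functor.obj X →ₗ[ℚ] M.obj Y →ₗ[ℚ] M.obj (X.tens Y)
  smul_natural : ∀ {X X' Y Y' : Lindner O} (f : X ⟶ X') (g : Y ⟶ Y')
    (a : A.functor.obj X) (m : M.obj Y),
    smul X' Y' (A.functor.map f a) (M.map g m) = M.map (tensMap f g) (smul X Y a m)
  mul_smul : ∀ {X Y Z : Lindner O} (a : A.functor.obj X) (b : A.functor.obj Y) (m : M.obj Z),
    M.map (assoc X Y Z) (smul (X.tens Y) Z (A.mul X Y a b) m) =
      smul X (Y.tens Z) a (smul Y Z b m)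
  one_smul : ∀ {X : Lindner O} (m : M.obj X), M.map (lunit X) (smul pt X A.one m) = m

/-- A module over a Green functor: a rational Mackey functor with an action. -/
structure GreenModule {G : Type u} [Group G] {O : TransferSystem G} (A : GreenFunctor.{u, w} O) where
  mackey : RatMackey.{u, v} O
  action : GreenAction A mackey.obj

namespace GreenModule

variable {G : Type u} [Group G] {O : TransferSystem G} {A : GreenFunctor.{u, w} O}

/-- Maps of modules: maps of Mackey functors that commute with the action. -/
@[ext]
structure Hom (M N : GreenModule.{u, v, w} A) where
  hom : M.mackey ⟶ N.mackey
  map_smul : ∀ (X Y : Lindner O) (a : A.functor.obj X) (m : M.mackey.obj.obj Y),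
    hom.hom.app (X.tens Y) (M.action.smul X Y a m) =
      N.action.smul X Y a (hom.hom.app Y m)

instance : Category (GreenModule.{u, v, w} A) where
  Hom := Hom
  id M := ⟨𝟙 M.mackey, fun _ _ _ _ => rfl⟩
  comp f g := ⟨f.hom ≫ g.hom, fun X Y a m => by
    change g.hom.hom.app _ (f.hom.hom.app _ _) = _
    rw [f.map_smul, g.map_smul]; rfl⟩

@[ext]
lemma hom_ext {M N : GreenModule.{u, v, w} A} {f g : M ⟶ N} (h : f.hom = g.hom) : f = g :=
  Hom.ext h

variable (A) in
/-- The functor that forgets the action. -/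
def forget : GreenModule.{u, v, w} A ⥤ RatMackey.{u, v} O where
  obj M := M.mackey
  map f := f.hom

end GreenModule

/-! ### The action of an element of `A(G/G)` -/

namespace GreenAction

variable {G : Type u} [Group G] {O : TransferSystem G} {A : GreenFunctor.{u, w} O}
  {M : Lindner O ⥤ ModuleCat.{v} ℚ} (σ : GreenAction A M)

/-- The action of `e ∈ A(G/G)` on `M(X)`, through `G/G × X ≅ X`. -/
def act (e : A.functor.obj pt) (X : Lindner O) : M.obj X →ₗ[ℚ] M.obj X :=
  (M.map (lunit X)).hom ∘ₗ σ.smul pt X e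

lemma act_apply (e : A.functor.obj pt) (X : Lindner O) (m : M.obj X) :
    σ.act e X m = M.map (lunit X) (σ.smul pt X e m) := rfl

lemma act_natural (e : A.functor.obj pt) {X Y : Lindner O} (f : X ⟶ Y) (m : M.obj X) :
    σ.act e Y (M.map f m) = M.map f (σ.act e X m) := by
  have h := σ.smul_natural (𝟙 pt) f e m
  rw [A.functor.map_id] at h
  rw [act_apply, act_apply]
  change M.map (lunit Y) (σ.smul pt Y ((𝟙 (A.functor.obj pt) : _ ⟶ _) e) (M.map f m)) = _
  rw [h, ← ConcreteCategory.comp_apply, ← ConcreteCategory.comp_apply, ← M.map_comp,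
    ← M.map_comp, lunit_natural]

end GreenAction

namespace GreenFunctor

variable {G : Type u} [Group G] {O : TransferSystem G} (A : GreenFunctor.{u, w} O)

/-- The action of a Green functor on itself. -/
def selfAction : GreenAction A A.functor where
  smul := A.mul
  smul_natural := A.mul_natural
  mul_smul := A.mul_assoc
  one_smul := A.one_mul

/-- The Mackey functor underlying a Green functor. -/
def mackey : RatMackey.{u, w} O := ⟨A.functor, A.isMackey⟩

/-- The idempotents of the ring `A(G/G)`. -/
def Idem : Type w := {e : A.functor.obj pt // A.selfAction.act e pt e = e}

end GreenFunctor

namespace GreenAction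

variable {G : Type u} [Group G] {O : TransferSystem G} {A : GreenFunctor.{u, w} O}
  {M : Lindner O ⥤ ModuleCat.{v} ℚ} (σ : GreenAction A M)

lemma act_smul (e : A.functor.obj pt) {X Y : Lindner O} (a : A.functor.obj X) (m : M.obj Y) :
    σ.act e (X.tens Y) (σ.smul X Y a m) = σ.smul X Y (A.selfAction.act e X a) m := by
  rw [act_apply, ← σ.mul_smul, ← ConcreteCategory.comp_apply, ← M.map_comp, assoc_lunit]
  have h := σ.smul_natural (lunit X) (𝟙 Y) (A.mul pt X e a) m
  rw [M.map_id] at h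
  exact h.symm

lemma act_act (e e' : A.functor.obj pt) {X : Lindner O} (m : M.obj X) :
    σ.act e X (σ.act e' X m) = σ.act (A.selfAction.act e pt e') X m := by
  rw [σ.act_apply e', act_natural, act_smul]
  rfl

lemma act_idem (e : A.Idem) {X : Lindner O} (m : M.obj X) :
    σ.act e.1 X (σ.act e.1 X m) = σ.act e.1 X m := by
  rw [act_act, e.2]

lemma smul_act (e : A.functor.obj pt) {X Y : Lindner O} (a : A.functor.obj X) (m : M.obj Y) :
    σ.smul X Y a (σ.act e Y m) = σ.act e (X.tens Y) (σ.smul X Y a m) := by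
  have h1 := σ.smul_natural (𝟙 X) (lunit Y) a (σ.smul pt Y e m)
  rw [A.functor.map_id] at h1
  have h2 := σ.smul_natural (swap X pt ≫ lunit X) (𝟙 Y) (A.mul X pt a e) m
  rw [M.map_id] at h2
  have h3 : A.functor.map (swap X pt ≫ lunit X) (A.mul X pt a e) = A.selfAction.act e X a := by
    rw [A.functor.map_comp, ConcreteCategory.comp_apply, A.mul_comm]; rfl
  rw [act_smul, ← h3]
  refine h1.trans (Eq.trans ?_ h2.symm)
  rw [← σ.mul_smul, ← ConcreteCategory.comp_apply, ← M.map_comp, assoc_swap_lunit]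

/-! ### The pieces `e M` -/

variable (e : A.Idem)

lemma mem_range_act {X : Lindner O} {m : M.obj X} :
    m ∈ LinearMap.range (σ.act e.1 X) ↔ σ.act e.1 X m = m :=
  ⟨by rintro ⟨m, rfl⟩; exact σ.act_idem e m, fun h => ⟨m, h⟩⟩

/-- The functor `e M`, with `(e M)(X) = e · M(X)`. -/
def piece : Lindner O ⥤ ModuleCat.{v} ℚ where
  obj X := ModuleCat.of ℚ (LinearMap.range (σ.act e.1 X))
  map {X Y} f := ModuleCat.ofHom ((M.map f).hom.restrict (by
    rintro _ ⟨m, rfl⟩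
    exact ⟨M.map f m, σ.act_natural e.1 f m⟩))
  map_id X := ModuleCat.hom_ext (LinearMap.ext fun m =>
    Subtype.ext (ConcreteCategory.congr_hom (M.map_id X) m.1))
  map_comp f g := ModuleCat.hom_ext (LinearMap.ext fun m =>
    Subtype.ext (ConcreteCategory.congr_hom (M.map_comp f g) m.1))

/-- The inclusion `e M → M`. -/
def pieceIncl : σ.piece e ⟶ M where
  app X := ModuleCat.ofHom (LinearMap.range (σ.act e.1 X)).subtype
  naturality X Y f := rfl

/-- The projection `M → e M`, given by multiplication with `e`. -/
def pieceProj : M ⟶ σ.piece e where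
  app X := ModuleCat.ofHom (σ.act e.1 X).rangeRestrict
  naturality X Y f := by
    ext m
    exact Subtype.ext (σ.act_natural e.1 f m)

lemma pieceIncl_proj : σ.pieceIncl e ≫ σ.pieceProj e = 𝟙 _ := by
  ext X m
  exact Subtype.ext ((σ.mem_range_act e).1 m.2)

lemma piece_isMackey (h : PreservesFiniteProducts M) : PreservesFiniteProducts (σ.piece e) :=
  preservesFiniteProducts_of_retract _ _ (σ.pieceIncl_proj e) h

/-- The multiplication map `(e A)(X) × (e M)(Y) → (e M)(X × Y)`. -/
def pieceSMul (X Y : Lindner O) : (A.selfAction.piece e).obj X →ₗ[ℚ]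
    (σ.piece e).obj Y →ₗ[ℚ] (σ.piece e).obj (X.tens Y) :=
  LinearMap.mk₂ ℚ (fun a m => ⟨σ.smul X Y a.1 m.1, (σ.mem_range_act e).2 (by
      rw [act_smul, (A.selfAction.mem_range_act e).1 a.2])⟩)
    (fun a b m => Subtype.ext (LinearMap.map_add₂ _ _ _ _))
    (fun c a m => Subtype.ext (LinearMap.map_smul₂ _ _ _ _))
    (fun a m n => Subtype.ext (map_add _ _ _))
    (fun c a m => Subtype.ext (map_smul _ _ _))

end GreenAction

namespace GreenFunctor

variable {G : Type u} [Group G] {O : TransferSystem G} (A : GreenFunctor.{u, w} O) (e : A.Idem)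

/-- The Green functor `e A`, with `(e A)(X) = e · A(X)`, the multiplication of `A`, and unit `e`. -/
def piece : GreenFunctor.{u, w} O where
  functor := A.selfAction.piece e
  isMackey := A.selfAction.piece_isMackey e A.isMackey
  one := ⟨e.1, (A.selfAction.mem_range_act e).2 e.2⟩
  mul := A.selfAction.pieceSMul e
  mul_natural f g a b := Subtype.ext (A.mul_natural f g a.1 b.1)
  mul_assoc a b c := Subtype.ext (A.mul_assoc a.1 b.1 c.1)
  one_mul a := Subtype.ext ((A.selfAction.mem_range_act e).1 a.2)
  mul_comm a b := Subtype.ext (A.mul_comm a.1 b.1)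

/-- The map of Green functors `A → e A`, `a ↦ e a`. -/
def toPiece (X : Lindner O) : A.functor.obj X →ₗ[ℚ] (A.piece e).functor.obj X :=
  (A.selfAction.act e.1 X).rangeRestrict

lemma toPiece_natural {X Y : Lindner O} (f : X ⟶ Y) (a : A.functor.obj X) :
    A.toPiece e Y (A.functor.map f a) = (A.piece e).functor.map f (A.toPiece e X a) :=
  Subtype.ext (A.selfAction.act_natural e.1 f a)

lemma toPiece_mul {X Y : Lindner O} (a : A.functor.obj X) (b : A.functor.obj Y) :
    A.toPiece e (X.tens Y) (A.mul X Y a b) =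
      (A.piece e).mul X Y (A.toPiece e X a) (A.toPiece e Y b) := by
  refine Subtype.ext ?_
  change A.selfAction.act e.1 _ (A.selfAction.smul X Y a b) =
    A.selfAction.smul X Y (A.selfAction.act e.1 X a) (A.selfAction.act e.1 Y b)
  rw [GreenAction.smul_act, ← GreenAction.act_smul, GreenAction.act_idem]

lemma toPiece_one : A.toPiece e pt A.one = (A.piece e).one := by
  refine Subtype.ext ?_
  change A.functor.map (lunit pt) (A.mul pt pt e.1 A.one) = e.1
  rw [← A.mul_comm A.one e.1, ← ConcreteCategory.comp_apply, ← A.functor.map_comp, swap_lunit_pt,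
    A.one_mul]

end GreenFunctor

namespace GreenModule

variable {G : Type u} [Group G] {O : TransferSystem G} {A : GreenFunctor.{u, w} O} (e : A.Idem)

/-- The `e A`-module `e M`. -/
def piece (M : GreenModule.{u, v, w} A) : GreenModule.{u, v, w} (A.piece e) where
  mackey := ⟨M.action.piece e, M.action.piece_isMackey e M.mackey.property⟩
  action :=
    { smul := M.action.pieceSMul e
      smul_natural := fun f g a m => Subtype.ext (M.action.smul_natural f g a.1 m.1)
      mul_smul := fun a b m => Subtype.ext (M.action.mul_smul a.1 b.1 m.1)
      one_smul := fun m => Subtype.ext ((M.action.mem_range_act e).1 m.2) }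

lemma map_act {M N : GreenModule.{u, v, w} A} (f : M ⟶ N) (e : A.functor.obj pt) {X : Lindner O}
    (m : M.mackey.obj.obj X) :
    f.hom.hom.app X (M.action.act e X m) = N.action.act e X (f.hom.hom.app X m) := by
  rw [GreenAction.act_apply, GreenAction.act_apply, ← f.map_smul]
  exact NatTrans.naturality_apply f.hom.hom (lunit X) _

/-- The functor `M ↦ e M` from `A`-modules to `e A`-modules. -/
def pieceFunctor : GreenModule.{u, v, w} A ⥤ GreenModule.{u, v, w} (A.piece e) where
  obj M := M.piece e
  map {M N} f :=
    { hom := ObjectProperty.homMk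
        { app := fun X => ModuleCat.ofHom ((f.hom.hom.app X).hom.restrict (by
            rintro _ ⟨m, rfl⟩
            exact ⟨f.hom.hom.app X m, (map_act f e.1 m).symm⟩))
          naturality := fun X Y g => by
            ext m
            exact Subtype.ext (NatTrans.naturality_apply f.hom.hom g m.1) }
      map_smul := fun X Y a m => Subtype.ext (f.map_smul X Y a.1 m.1) }
  map_id M := rfl
  map_comp f g := rfl

/-- Restriction of scalars along the map of Green functors `A → e A`, `a ↦ e a`: an `e A`-module is
regarded as an `A`-module via `a · m = (e a) · m`. -/
def restrictScalars : GreenModule.{u, v, w} (A.piece e) ⥤ GreenModule.{u, v, w} A where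
  obj N :=
    { mackey := N.mackey
      action :=
        { smul := fun X Y => N.action.smul X Y ∘ₗ A.toPiece e X
          smul_natural := fun {X X' Y Y'} f g a m => by
            rw [LinearMap.comp_apply, LinearMap.comp_apply, A.toPiece_natural]
            exact N.action.smul_natural f g _ m
          mul_smul := fun {X Y Z} a b m => by
            simp only [LinearMap.comp_apply]
            rw [A.toPiece_mul]
            exact N.action.mul_smul _ _ m
          one_smul := fun {X} m => by
            rw [LinearMap.comp_apply, A.toPiece_one]
            exact N.action.one_smul m } }
  map f := ⟨f.hom, fun X Y a m => f.map_smul X Y _ m⟩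
  map_id M := rfl
  map_comp f g := rfl

end GreenModule

/-! ### The rational Burnside Mackey functor -/

namespace GSpan

variable {G : Type u} [Group G] {O : TransferSystem G}

/-- The product of two spans out of `G/G`: `(U → X)` and `(V → Y)` give `U × V → X × Y`. -/
def pair {X Y : FinGSet G} (s : GSpan O FinGSet.pt X) (t : GSpan O FinGSet.pt Y) :
    GSpan O FinGSet.pt (X.prod Y) where
  apex := s.apex.prod t.apex
  left := { toFun := fun _ => PUnit.unit, map_smul' := fun _ _ => rfl }
  right := (s.prod t).right
  adm := (s.prod t).adm

end GSpan

namespace Lindner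

variable {G : Type u} [Group G] {O : TransferSystem G}

/-- The product of isomorphism classes of spans out of `G/G`. -/
def pair {X Y : Lindner O} : (pt ⟶ X) → (pt ⟶ Y) → (pt ⟶ X.tens Y) :=
  Quotient.map₂ GSpan.pair (by
    rintro s s' ⟨e, h1, h2, h3⟩ t t' ⟨e', h1', h2', h3'⟩
    refine ⟨Equiv.prodCongr e e', fun g p => ?_, fun p => rfl, fun p => ?_⟩
    · exact Prod.ext (h1 _ _) (h1' _ _)
    · exact Prod.ext (h3 _) (h3' _))

lemma pair_natural {X X' Y Y' : Lindner O} (s : pt ⟶ X) (t : pt ⟶ Y) (f : X ⟶ X') (g : Y ⟶ Y') :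
    pair (s ≫ f) (t ≫ g) = pair s t ≫ tensMap f g := by
  induction s using ind with
  | h s =>
  induction t using ind with
  | h t =>
  induction f using ind with
  | h f =>
  induction g using ind with
  | h g =>
    exact sound ⟨⟨fun p => ⟨((p.1.1.1, p.2.1.1), (p.1.1.2, p.2.1.2)), Prod.ext p.1.2 p.2.2⟩,
        fun p => (⟨(p.1.1.1, p.1.2.1), congrArg Prod.fst p.2⟩,
          ⟨(p.1.1.2, p.1.2.2), congrArg Prod.snd p.2⟩),
        fun p => rfl, fun p => rfl⟩,
      fun g p => rfl, fun p => rfl, fun p => rfl⟩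

lemma pair_assoc {X Y Z : Lindner O} (f : pt ⟶ X) (g : pt ⟶ Y) (h : pt ⟶ Z) :
    pair (pair f g) h ≫ assoc X Y Z = pair f (pair g h) := by
  induction f using ind with
  | h r =>
  induction g using ind with
  | h s =>
  induction h using ind with
  | h t =>
    exact sound ⟨⟨fun p => (p.1.1.1.1, (p.1.1.1.2, p.1.1.2)),
        fun p => ⟨(((p.1, p.2.1), p.2.2), ((r.right p.1, s.right p.2.1), t.right p.2.2)), rfl⟩,
        fun p => Subtype.ext (Prod.ext rfl p.2), fun p => rfl⟩,
      fun g p => rfl, fun p => rfl,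
      fun p => congrArg (fun t : (X.set × Y.set) × Z.set => (t.1.1, (t.1.2, t.2))) p.2⟩

lemma pair_id {X : Lindner O} (f : pt ⟶ X) : pair (𝟙 pt) f ≫ lunit X = f := by
  induction f using ind with
  | h r =>
    exact sound ⟨⟨fun p => p.1.1.2,
        fun p => ⟨((PUnit.unit, p), (PUnit.unit, r.right p)), rfl⟩,
        fun p => Subtype.ext (Prod.ext rfl p.2), fun p => rfl⟩,
      fun g p => rfl, fun p => rfl, fun p => congrArg Prod.snd p.2⟩

lemma pair_swap {X Y : Lindner O} (f : pt ⟶ X) (g : pt ⟶ Y) :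
    pair f g ≫ swap X Y = pair g f := by
  induction f using ind with
  | h s =>
  induction g using ind with
  | h t =>
    exact sound ⟨⟨fun p => (p.1.1.2, p.1.1.1),
        fun p => ⟨((p.2, p.1), (s.right p.2, t.right p.1)), rfl⟩,
        fun p => Subtype.ext (Prod.ext rfl p.2), fun p => rfl⟩,
      fun g p => rfl, fun p => rfl, fun p => congrArg (fun t : X.set × Y.set => (t.2, t.1)) p.2⟩

lemma add_pair {X Y : Lindner O} (f f' : pt ⟶ X) (g : pt ⟶ Y) :
    pair (f + f') g = pair f g + pair f' g := by
  induction f using ind with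
  | h s =>
  induction f' using ind with
  | h s' =>
  induction g using ind with
  | h t =>
    refine sound ⟨Equiv.sumProdDistrib _ _ _, ?_, ?_, ?_⟩
    · rintro g ⟨p | p, q⟩ <;> rfl
    · rintro ⟨p | p, q⟩ <;> rfl
    · rintro ⟨p | p, q⟩ <;> rfl

lemma zero_pair {X Y : Lindner O} (g : pt ⟶ Y) : pair (0 : pt ⟶ X) g = 0 := by
  induction g using ind with
  | h t =>
    exact sound ⟨⟨fun p => PEmpty.elim p.1, fun p => PEmpty.elim p, fun p => PEmpty.elim p.1,
      fun p => PEmpty.elim p⟩, fun g p => PEmpty.elim p.1, fun p => PEmpty.elim p.1,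
      fun p => PEmpty.elim p.1⟩

lemma pair_add {X Y : Lindner O} (f : pt ⟶ X) (g g' : pt ⟶ Y) :
    pair f (g + g') = pair f g + pair f g' := by
  rw [← pair_swap, add_pair, add_comp, pair_swap, pair_swap]

lemma pair_zero {X Y : Lindner O} (f : pt ⟶ X) : pair f (0 : pt ⟶ Y) = 0 := by
  rw [← pair_swap, zero_pair, zero_comp]

/-- `A^O(X)`: the Grothendieck group of the monoid of isomorphism classes of finite `G`-sets over
`X` with structure map in the indexing category of `O`. For `X = G/H` these correspond to finite
`H`-sets all of whose orbits `H/K` are `O`-admissible, so `A^O(G/H)` is free on the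
`O`-admissible orbits of `H`. -/
abbrev BurnsideGroup (X : Lindner O) : Type (u + 1) :=
  Algebra.GrothendieckAddGroup (pt ⟶ X)

/-- `A^O_ℚ(X) = ℚ ⊗ A^O(X)`. -/
abbrev RatBurnside (X : Lindner O) : Type (u + 1) := ℚ ⊗[ℤ] BurnsideGroup X

namespace RatBurnside

/-- The class of an admissible `G`-set over `X`. -/
noncomputable def gen {X : Lindner O} : (pt ⟶ X) →+ RatBurnside X :=
  (TensorProduct.mk ℤ ℚ (BurnsideGroup X) 1).toAddMonoidHom.comp Algebra.GrothendieckAddGroup.of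

/-- Linear extension of an additive map. -/
noncomputable def lift {X : Lindner O} {W : Type w} [AddCommGroup W] [Module ℚ W]
    (φ : (pt ⟶ X) →+ W) : RatBurnside X →ₗ[ℚ] W :=
  LinearMap.liftBaseChange ℚ (Algebra.GrothendieckAddGroup.lift φ).toIntLinearMap

lemma lift_gen {X : Lindner O} {W : Type w} [AddCommGroup W] [Module ℚ W]
    (φ : (pt ⟶ X) →+ W) (f : pt ⟶ X) : lift φ (gen f) = φ f := by
  simp only [lift, gen, AddMonoidHom.comp_apply, LinearMap.toAddMonoidHom_coe, TensorProduct.mk_apply,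
    LinearMap.liftBaseChange_tmul, one_smul]
  exact DFunLike.congr_fun (Algebra.GrothendieckAddGroup.lift.symm_apply_apply φ) f

lemma induction {X : Lindner O} {p : RatBurnside X → Prop} (hgen : ∀ f, p (gen f))
    (hadd : ∀ a b, p a → p b → p (a + b)) (hsmul : ∀ (c : ℚ) a, p a → p (c • a))
    (a : RatBurnside X) : p a := by
  induction a using TensorProduct.induction_on with
  | zero => simpa using hsmul 0 _ (hgen 0)
  | add a b ha hb => exact hadd a b ha hb
  | tmul c k =>
    have h1 : c ⊗ₜ[ℤ] k = c • ((1 : ℚ) ⊗ₜ[ℤ] k) := by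
      rw [TensorProduct.smul_tmul', smul_eq_mul, mul_one]
    rw [h1]
    apply hsmul
    induction k using AddLocalization.ind with
    | H y =>
      obtain ⟨x, y, hy⟩ := y
      have h2 : AddLocalization.mk x ⟨y, hy⟩ = Algebra.GrothendieckAddGroup.of x -
          Algebra.GrothendieckAddGroup.of (M := pt ⟶ X) y := by
        rw [Algebra.GrothendieckAddGroup.of]
        change _ = AddLocalization.addMonoidOf _ x - AddLocalization.addMonoidOf _ y
        rw [← AddLocalization.mk_zero_eq_addMonoidOf_mk,
          ← AddLocalization.mk_zero_eq_addMonoidOf_mk, Algebra.GrothendieckAddGroup.mk_sub_mk]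
        simp
      rw [h2, sub_eq_add_neg, TensorProduct.tmul_add, TensorProduct.tmul_neg, ← neg_one_smul ℚ]
      exact hadd _ _ (hgen x) (hsmul _ _ (hgen y))

lemma hom_ext {X : Lindner O} {W : Type w} [AddCommGroup W] [Module ℚ W]
    {φ ψ : RatBurnside X →ₗ[ℚ] W} (h : ∀ f, φ (gen f) = ψ (gen f)) : φ = ψ := by
  refine LinearMap.ext fun a => ?_
  induction a using induction with
  | hgen f => exact h f
  | hadd a b ha hb => rw [map_add, map_add, ha, hb]
  | hsmul c a ha => rw [map_smul, map_smul, ha]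

/-- Functoriality of `A^O_ℚ`. -/
noncomputable def map {X Y : Lindner O} (f : X ⟶ Y) : RatBurnside X →ₗ[ℚ] RatBurnside Y :=
  lift (gen.comp ⟨⟨fun s => s ≫ f, zero_comp f⟩, fun s t => add_comp s t f⟩)

lemma map_gen {X Y : Lindner O} (f : X ⟶ Y) (s : pt ⟶ X) : map f (gen s) = gen (s ≫ f) :=
  lift_gen _ _

/-- The multiplication of `A^O_ℚ`, induced by the product of `G`-sets. -/
noncomputable def mul (X Y : Lindner O) :
    RatBurnside X →ₗ[ℚ] RatBurnside Y →ₗ[ℚ] RatBurnside (X.tens Y) :=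
  lift
    { toFun := fun s => lift (gen.comp ⟨⟨fun t => pair s t, pair_zero s⟩, fun t t' => pair_add s t t'⟩)
      map_zero' := hom_ext fun t => by
        rw [lift_gen]
        change gen (pair 0 t) = 0
        rw [zero_pair, map_zero]
      map_add' := fun s s' => hom_ext fun t => by
        rw [lift_gen, LinearMap.add_apply, lift_gen, lift_gen]
        change gen (pair (s + s') t) = gen (pair s t) + gen (pair s' t)
        rw [add_pair, map_add] }

lemma mul_gen {X Y : Lindner O} (s : pt ⟶ X) (t : pt ⟶ Y) :
    mul X Y (gen s) (gen t) = gen (pair s t) := by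
  rw [mul, lift_gen]
  exact lift_gen _ _

end RatBurnside

end Lindner

variable {G : Type u} [Group G] (O : TransferSystem G)

open RatBurnside in
/-- The rational `O`-Burnside Mackey functor `A^O_ℚ`, as a Green functor. -/
noncomputable def burnside : GreenFunctor.{u, u + 1} O where
  functor :=
    { obj := fun X => ModuleCat.of ℚ (RatBurnside X)
      map := fun f => ModuleCat.ofHom (RatBurnside.map f)
      map_id := fun X => ModuleCat.hom_ext (RatBurnside.hom_ext fun s => by
        rw [ModuleCat.hom_ofHom, map_gen, Category.comp_id]; rfl)
      map_comp := fun f g => ModuleCat.hom_ext (RatBurnside.hom_ext fun s => by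
        rw [ModuleCat.hom_ofHom, map_gen, ← Category.assoc, ModuleCat.hom_comp,
          LinearMap.comp_apply, ModuleCat.hom_ofHom, ModuleCat.hom_ofHom, map_gen, map_gen]) }
  isMackey := preservesFiniteProducts_of_additive _
    (fun f g => ModuleCat.hom_ext (RatBurnside.hom_ext fun s => by
      change RatBurnside.map (f + g) (gen s) =
        RatBurnside.map f (gen s) + RatBurnside.map g (gen s)
      rw [map_gen, map_gen, map_gen, Lindner.comp_add, map_add]))
    (fun X Y => ModuleCat.hom_ext (RatBurnside.hom_ext fun s => by
      change RatBurnside.map 0 (gen s) = 0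
      rw [map_gen, Lindner.comp_zero, map_zero]))
  one := gen (𝟙 pt)
  mul := RatBurnside.mul
  mul_natural {X X' Y Y'} f g a b := by
    change RatBurnside.mul X' Y' (RatBurnside.map f a) (RatBurnside.map g b) =
      RatBurnside.map (tensMap f g) (RatBurnside.mul X Y a b)
    induction a using RatBurnside.induction with
    | hadd a a' ha ha' => simp only [map_add, LinearMap.add_apply, ha, ha']
    | hsmul c a ha => simp only [map_smul, LinearMap.smul_apply, ha]
    | hgen s =>
    induction b using RatBurnside.induction with
    | hadd b b' hb hb' => simp only [map_add, hb, hb']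
    | hsmul c b hb => simp only [map_smul, hb]
    | hgen t => rw [map_gen, map_gen, mul_gen, mul_gen, map_gen, pair_natural]
  mul_assoc {X Y Z} a b c := by
    change RatBurnside.map (assoc X Y Z)
      (RatBurnside.mul (X.tens Y) Z (RatBurnside.mul X Y a b) c) =
      RatBurnside.mul X (Y.tens Z) a (RatBurnside.mul Y Z b c)
    induction a using RatBurnside.induction with
    | hadd a a' ha ha' => simp only [map_add, LinearMap.add_apply, ha, ha']
    | hsmul c a ha => simp only [map_smul, LinearMap.smul_apply, ha]
    | hgen s =>
    induction b using RatBurnside.induction with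
    | hadd b b' hb hb' => simp only [map_add, LinearMap.add_apply, hb, hb']
    | hsmul c b hb => simp only [map_smul, LinearMap.smul_apply, hb]
    | hgen t =>
    induction c using RatBurnside.induction with
    | hadd c c' hc hc' => simp only [map_add, hc, hc']
    | hsmul r c hc => simp only [map_smul, hc]
    | hgen r => rw [mul_gen, mul_gen, mul_gen, mul_gen, map_gen, pair_assoc]
  one_mul {X} a := by
    change RatBurnside.map (lunit X) (RatBurnside.mul pt X (gen (𝟙 pt)) a) = a
    induction a using RatBurnside.induction with
    | hadd a a' ha ha' => simp only [map_add, ha, ha']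
    | hsmul c a ha => simp only [map_smul, ha]
    | hgen s => rw [mul_gen, map_gen, pair_id]
  mul_comm {X Y} a b := by
    change RatBurnside.map (swap X Y) (RatBurnside.mul X Y a b) = RatBurnside.mul Y X b a
    induction a using RatBurnside.induction with
    | hadd a a' ha ha' => simp only [map_add, LinearMap.add_apply, ha, ha']
    | hsmul c a ha => simp only [map_smul, LinearMap.smul_apply, ha]
    | hgen s =>
    induction b using RatBurnside.induction with
    | hadd b b' hb hb' => simp only [map_add, LinearMap.add_apply, hb, hb']
    | hsmul c b hb => simp only [map_smul, LinearMap.smul_apply, hb]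
    | hgen t => rw [mul_gen, mul_gen, map_gen, pair_swap]

/-! ### The idempotents -/

namespace TransferSystem

/-- The poset `Sub^O(G)` of subgroups `H` with `H → G` in `O`. -/
def AdmSub : Type u := {H : Subgroup G // O.Rel H ⊤}

/-- Conjugacy in `G` of elements of `Sub^O(G)`. -/
instance conjSetoid : Setoid O.AdmSub where
  r H K := ∃ g : G, H.1.map (MulAut.conj g).toMonoidHom = K.1
  iseqv :=
    { refl := fun H => ⟨1, by ext; simp⟩
      symm := by
        rintro H K ⟨g, hg⟩
        refine ⟨g⁻¹, ?_⟩
        rw [← hg, Subgroup.map_map]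
        convert Subgroup.map_id H.1
        ext x
        simp
        group
      trans := by
        rintro H K L ⟨g, hg⟩ ⟨g', hg'⟩
        refine ⟨g' * g, ?_⟩
        rw [← hg', ← hg, Subgroup.map_map]
        congr 1
        ext x
        simp [mul_assoc] }

/-- The set `Sub^O(G)/G` of conjugacy classes `(H)` of subgroups with `H → G` in `O`. -/
def ConjClass : Type u := Quotient O.conjSetoid

end TransferSystem

/-- The number of `H`-fixed points of a finite `G`-set, given as a span `G/G ← U → G/G`. -/
noncomputable def fixCount (H : Subgroup G) : ((pt : Lindner O) ⟶ pt) → ℚ :=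
  Quotient.lift (fun s : GSpan O FinGSet.pt FinGSet.pt =>
      (Nat.card (MulAction.fixedPoints H s.apex) : ℚ)) (by
    rintro s t ⟨e, h, -, -⟩
    refine congrArg Nat.cast (Nat.card_congr (e.subtypeEquiv fun x => forall_congr' fun g => ?_))
    change g.1 • x = x ↔ g.1 • e x = e x
    rw [← h, e.apply_eq_iff_eq])

/-- The number of `H`-fixed points is additive. -/
noncomputable def fixCountHom (H : Subgroup G) : ((pt : Lindner O) ⟶ pt) →+ ℚ where
  toFun := fixCount O H
  map_zero' := by
    change (Nat.card (MulAction.fixedPoints H (FinGSet.empty : FinGSet G)) : ℚ) = 0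
    have : IsEmpty (MulAction.fixedPoints H (FinGSet.empty : FinGSet G)) :=
      ⟨fun x => PEmpty.elim x.1⟩
    simp
  map_add' f g := by
    induction f using Lindner.ind with
    | h s =>
    induction g using Lindner.ind with
    | h t =>
      change (Nat.card (MulAction.fixedPoints H (s.apex.sum t.apex)) : ℚ) =
        Nat.card (MulAction.fixedPoints H s.apex) + Nat.card (MulAction.fixedPoints H t.apex)
      rw [← Nat.cast_add, ← Nat.card_sum]
      refine congrArg Nat.cast (Nat.card_congr ⟨?_, ?_, ?_, ?_⟩)
      · rintro ⟨x | x, hx⟩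
        · exact Sum.inl ⟨x, fun g => Sum.inl_injective (hx g)⟩
        · exact Sum.inr ⟨x, fun g => Sum.inr_injective (hx g)⟩
      · rintro (x | x)
        · exact ⟨Sum.inl x.1, fun g => congrArg Sum.inl (x.2 g)⟩
        · exact ⟨Sum.inr x.1, fun g => congrArg Sum.inr (x.2 g)⟩
      · rintro ⟨x | x, hx⟩ <;> rfl
      · rintro (x | x) <;> rfl

/-- The rational ghost coordinate map `A^O_ℚ(G/G) → {functions on Sub^O(G)}`, which sends a finite
`G`-set `T` to `H ↦ |T^H|`. -/
noncomputable def ghost : (burnside O).functor.obj pt →ₗ[ℚ] (O.AdmSub → ℚ) :=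
  LinearMap.pi fun H => RatBurnside.lift (fixCountHom O H.1)

open Classical in
/-- The characteristic function of a conjugacy class in `Sub^O(G)`. -/
noncomputable def delta (c : O.ConjClass) : O.AdmSub → ℚ :=
  fun K => if (Quotient.mk O.conjSetoid K : O.ConjClass) = c then 1 else 0

/-! ### The pieces of a Mackey functor -/

namespace GreenAction

variable {O} {A : GreenFunctor.{u, w} O} {M : RatMackey.{u, v} O} (σ : GreenAction A M.obj)
  (e : A.Idem)

/-- The Mackey functor `e M`. -/
def mackeyPiece : RatMackey.{u, v} O := ⟨σ.piece e, σ.piece_isMackey e M.property⟩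

/-- The inclusion `e M → M`. -/
def mackeyIncl : σ.mackeyPiece e ⟶ M := ObjectProperty.homMk (σ.pieceIncl e)

/-- The projection `M → e M`, multiplication with `e`. -/
def mackeyProj : M ⟶ σ.mackeyPiece e := ObjectProperty.homMk (σ.pieceProj e)

end GreenAction

/-- The functor `M ↦ (e_c M)_c` from `A`-modules to the product of the categories of
`e_c A`-modules, for a family of idempotents `e_c` of `A(G/G)`. -/
def splitting {O : TransferSystem G} {A : GreenFunctor.{u, w} O} {C : Type u} (e : C → A.Idem) :
    GreenModule.{u, v, w} A ⥤ ((c : C) → GreenModule.{u, v, w} (A.piece (e c))) :=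
  Functor.pi' fun c => GreenModule.pieceFunctor (e c)

end OMackey

open OMackey

/-!
The Lindner category has finite biproducts, given by disjoint union, so a product preserving functor
on it is automatically additive (`map_add_of_preservesFiniteProducts`). A class `U → X` in the
Burnside functor can therefore act on a Mackey functor through the span `Y ← U × Y → X × Y`, and
the action extends linearly (`burnsideAction`). Unitality and naturality leave no other choice,
because `U → X` is the image of `1 ∈ A(G/G)` under the corresponding morphism `G/G ⟶ X`
(`burnside_smul_gen`). So Mackey functors and modules over the Burnside functor are the same thing.

The table of marks restricted to `Sub^O(G)` is triangular with nonzero diagonal when the classes are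
ordered by the order of the subgroups, and the orbits `G/H` span `A^O_ℚ(G/G)`. Hence the ghost map
identifies the ring `A^O_ℚ(G/G)` with the ring of class functions on `Sub^O(G)`
(`reducedGhost_bijective`, `ghost_act`), and the characteristic functions of the conjugacy classes
come from a complete family of orthogonal idempotents (`completeOrthogonal_classIdem`).

For any Green functor `A`, a finite complete family of orthogonal idempotents of `A(G/G)` splits
each module into its pieces (`isBilimitPieces`). Restriction of scalars to `A` from a piece of `A` is
fully faithful because `A → e A` is surjective. Maps between modules over different pieces vanish,
since they commute with an idempotent that is `1` on one side and `0` on the other. A family of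
modules over the pieces of `A` is recovered as the splitting of the biproduct of its members
(`splitting_essSurj`).
-/

namespace OMackey

/-! ### Biproducts in the Lindner category, and additivity of Mackey functors -/

namespace Lindner

variable {G : Type u} [Group G] {O : TransferSystem G}

/-- The disjoint union of two objects of the Lindner category, which is their biproduct. -/
def biprod (X Y : Lindner O) : Lindner O := ⟨X.set.sum Y.set⟩

/-- The covariant span of the inclusion `X → X ⊔ Y`. -/
def inl (X Y : Lindner O) : X ⟶ biprod X Y :=
  mk (S := X) (T := biprod X Y) (GSpan.ofInj
    { toFun := fun x => (Sum.inl x : X.set ⊕ Y.set), map_smul' := fun _ _ => rfl }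
    Sum.inl_injective)

/-- The covariant span of the inclusion `Y → X ⊔ Y`. -/
def inr (X Y : Lindner O) : Y ⟶ biprod X Y :=
  mk (S := Y) (T := biprod X Y) (GSpan.ofInj
    { toFun := fun x => (Sum.inr x : X.set ⊕ Y.set), map_smul' := fun _ _ => rfl }
    Sum.inr_injective)

/-- The contravariant span of the inclusion `X → X ⊔ Y`. -/
def fst (X Y : Lindner O) : biprod X Y ⟶ X :=
  mk (S := biprod X Y) (T := X) ⟨X.set,
    { toFun := fun x => (Sum.inl x : X.set ⊕ Y.set), map_smul' := fun _ _ => rfl },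
    MulActionHom.id G, fun _ => O.refl _⟩

/-- The contravariant span of the inclusion `Y → X ⊔ Y`. -/
def snd (X Y : Lindner O) : biprod X Y ⟶ Y :=
  mk (S := biprod X Y) (T := Y) ⟨Y.set,
    { toFun := fun x => (Sum.inr x : X.set ⊕ Y.set), map_smul' := fun _ _ => rfl },
    MulActionHom.id G, fun _ => O.refl _⟩

lemma inl_fst (X Y : Lindner O) : inl X Y ≫ fst X Y = 𝟙 X :=
  sound ⟨⟨fun p => p.1.1, fun x => ⟨(x, x), rfl⟩,
      fun p => Subtype.ext (Prod.ext rfl (Sum.inl_injective p.2)), fun _ => rfl⟩,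
    fun _ _ => rfl, fun _ => rfl, fun p => Sum.inl_injective p.2⟩

lemma inr_snd (X Y : Lindner O) : inr X Y ≫ snd X Y = 𝟙 Y :=
  sound ⟨⟨fun p => p.1.1, fun x => ⟨(x, x), rfl⟩,
      fun p => Subtype.ext (Prod.ext rfl (Sum.inr_injective p.2)), fun _ => rfl⟩,
    fun _ _ => rfl, fun _ => rfl, fun p => Sum.inr_injective p.2⟩

lemma inl_snd (X Y : Lindner O) : inl X Y ≫ snd X Y = 0 :=
  sound ⟨⟨fun p => (Sum.inl_ne_inr p.2).elim, fun p => PEmpty.elim p,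
      fun p => (Sum.inl_ne_inr p.2).elim, fun p => PEmpty.elim p⟩,
    fun _ p => (Sum.inl_ne_inr p.2).elim, fun p => (Sum.inl_ne_inr p.2).elim,
    fun p => (Sum.inl_ne_inr p.2).elim⟩

lemma inr_fst (X Y : Lindner O) : inr X Y ≫ fst X Y = 0 :=
  sound ⟨⟨fun p => (Sum.inr_ne_inl p.2).elim, fun p => PEmpty.elim p,
      fun p => (Sum.inr_ne_inl p.2).elim, fun p => PEmpty.elim p⟩,
    fun _ p => (Sum.inr_ne_inl p.2).elim, fun p => (Sum.inr_ne_inl p.2).elim,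
    fun p => (Sum.inr_ne_inl p.2).elim⟩

lemma fst_inl_add_snd_inr (X Y : Lindner O) :
    fst X Y ≫ inl X Y + snd X Y ≫ inr X Y = 𝟙 (biprod X Y) := by
  refine sound ⟨⟨?_, ?_, ?_, ?_⟩, ?_, ?_, ?_⟩
  · exact Sum.elim (fun p => Sum.inl p.1.1) (fun p => Sum.inr p.1.1)
  · exact Sum.elim (fun x => Sum.inl ⟨(x, x), rfl⟩) (fun x => Sum.inr ⟨(x, x), rfl⟩)
  · rintro (⟨⟨x, y⟩, h⟩ | ⟨⟨x, y⟩, h⟩) <;> obtain rfl : x = y := h <;> rfl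
  · rintro (x | x) <;> rfl
  · rintro g (x | x) <;> rfl
  · rintro (x | x) <;> rfl
  · rintro (⟨⟨x, y⟩, h⟩ | ⟨⟨x, y⟩, h⟩) <;> obtain rfl : x = y := h <;> rfl

/-- The map into `X ⊔ Y` with components `f` and `g`. -/
def pairing {W X Y : Lindner O} (f : W ⟶ X) (g : W ⟶ Y) : W ⟶ biprod X Y :=
  f ≫ inl X Y + g ≫ inr X Y

lemma pairing_fst {W X Y : Lindner O} (f : W ⟶ X) (g : W ⟶ Y) : pairing f g ≫ fst X Y = f := by
  rw [pairing, Lindner.add_comp, Category.assoc, Category.assoc, inl_fst, inr_fst,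
    Lindner.comp_zero, Category.comp_id, add_zero]

lemma pairing_snd {W X Y : Lindner O} (f : W ⟶ X) (g : W ⟶ Y) : pairing f g ≫ snd X Y = g := by
  rw [pairing, Lindner.add_comp, Category.assoc, Category.assoc, inl_snd, inr_snd,
    Lindner.comp_zero, Category.comp_id, zero_add]

lemma pairing_comp_fst_comp_snd {W X Y : Lindner O} (f : W ⟶ biprod X Y) :
    pairing (f ≫ fst X Y) (f ≫ snd X Y) = f := by
  rw [pairing, Category.assoc, Category.assoc, ← Lindner.comp_add, fst_inl_add_snd_inr,
    Category.comp_id]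

/-- The disjoint union is the product in the Lindner category. -/
def isLimitBiprod (X Y : Lindner O) : IsLimit (BinaryFan.mk (fst X Y) (snd X Y)) :=
  BinaryFan.isLimitMk (fun s => pairing s.fst s.snd) (fun _ => pairing_fst _ _)
    (fun _ => pairing_snd _ _)
    (fun s m h₁ h₂ => by rw [← h₁, ← h₂, pairing_comp_fst_comp_snd])

variable (O) in
/-- The empty `G`-set, the zero object of the Lindner category. -/
def emptyObj : Lindner O := ⟨FinGSet.empty⟩

lemma id_emptyObj : 𝟙 (emptyObj O) = 0 :=
  sound ⟨Equiv.refl PEmpty, fun _ p => PEmpty.elim p, fun p => PEmpty.elim p,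
    fun p => PEmpty.elim p⟩

variable (O) in
/-- The empty `G`-set is terminal in the Lindner category. -/
def isTerminalEmptyObj : IsTerminal (emptyObj O) :=
  IsTerminal.ofUniqueHom (fun _ => 0) fun _ f => by
    rw [← Category.comp_id f, id_emptyObj, Lindner.comp_zero]

end Lindner

section Additive

variable {G : Type u} [Group G] {O : TransferSystem G}

open Lindner

lemma map_zero_of_preservesFiniteProducts (F : Lindner O ⥤ ModuleCat.{v} ℚ)
    (hF : PreservesFiniteProducts F) (X Y : Lindner O) : F.map (0 : X ⟶ Y) = 0 := by
  have h : F.map (0 : X ⟶ emptyObj O) = 0 :=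
    ((isTerminalEmptyObj O).isTerminalObj F).hom_ext _ _
  rw [← Lindner.comp_zero (0 : X ⟶ emptyObj O), F.map_comp, h, Limits.zero_comp]

/-- A product-preserving functor is additive: `f + g` factors as `S → T ⊔ T → T`, and on
`F(T ⊔ T) ≅ F(T) × F(T)` the codiagonal `fst + snd` acts as the sum of the two projections. -/
lemma map_add_of_preservesFiniteProducts (F : Lindner O ⥤ ModuleCat.{v} ℚ)
    (hF : PreservesFiniteProducts F) {X Y : Lindner O} (f g : X ⟶ Y) :
    F.map (f + g) = F.map f + F.map g := by
  have hz := map_zero_of_preservesFiniteProducts F hF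
  have hl := mapIsLimitOfPreservesOfIsLimit F _ _ (isLimitBiprod Y Y)
  have hone : F.map (fst Y Y) ≫ F.map (inl Y Y) + F.map (snd Y Y) ≫ F.map (inr Y Y) = 𝟙 _ := by
    refine BinaryFan.IsLimit.hom_ext hl ?_ ?_
    · change (_ + _) ≫ F.map (fst Y Y) = 𝟙 _ ≫ F.map (fst Y Y)
      simp only [Preadditive.add_comp, Category.assoc, ← F.map_comp, inl_fst, inr_fst,
        Lindner.comp_zero, hz, Category.comp_id, Category.id_comp, add_zero]
    · change (_ + _) ≫ F.map (snd Y Y) = 𝟙 _ ≫ F.map (snd Y Y)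
      simp only [Preadditive.add_comp, Category.assoc, ← F.map_comp, inl_snd, inr_snd,
        Lindner.comp_zero, hz, Category.comp_id, Category.id_comp, zero_add]
  have hcodiag : F.map (fst Y Y + snd Y Y) = F.map (fst Y Y) + F.map (snd Y Y) := by
    rw [← Category.id_comp (F.map (fst Y Y + snd Y Y)), ← hone]
    simp only [Preadditive.add_comp, Category.assoc, ← F.map_comp, Lindner.comp_add, inl_fst,
      inl_snd, inr_fst, inr_snd, Category.comp_id, add_zero, zero_add]
  have h : f + g = pairing f g ≫ (fst Y Y + snd Y Y) := by
    rw [Lindner.comp_add, pairing_fst, pairing_snd]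
  rw [h, F.map_comp, hcodiag, Preadditive.comp_add, ← F.map_comp, ← F.map_comp, pairing_fst,
    pairing_snd]

end Additive

/-! ### Mackey functors as modules over the Burnside functor -/

namespace GSpan

variable {G : Type u} [Group G] {O : TransferSystem G}

/-- The exterior product of a finite `G`-set `U → X` over `X` with `Y`: the span
`Y ← U × Y → X × Y`. -/
def extProd {X : FinGSet G} (s : GSpan O FinGSet.pt X) (Y : FinGSet G) :
    GSpan O Y (X.prod Y) where
  apex := s.apex.prod Y
  left := { toFun := fun p => p.2, map_smul' := fun _ _ => rfl }
  right := (s.prod (GSpan.id Y)).right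
  adm := (s.prod (GSpan.id Y)).adm

end GSpan

namespace Lindner

variable {G : Type u} [Group G] {O : TransferSystem G}

/-- The exterior product `Y ⟶ X × Y` with a class `pt ⟶ X`. -/
def extProd {X : Lindner O} (s : pt ⟶ X) (Y : Lindner O) : Y ⟶ X.tens Y :=
  Quotient.map (fun s => GSpan.extProd s Y.set) (by
    rintro s s' ⟨e, h1, h2, h3⟩
    exact ⟨Equiv.prodCongr e (Equiv.refl _), fun g p => Prod.ext (h1 _ _) rfl, fun _ => rfl,
      fun p => Prod.ext (h3 _) rfl⟩) s

lemma add_extProd {X : Lindner O} (s t : pt ⟶ X) (Y : Lindner O) :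
    extProd (s + t) Y = extProd s Y + extProd t Y := by
  induction s using ind with
  | h s =>
  induction t using ind with
  | h t =>
    refine sound ⟨Equiv.sumProdDistrib _ _ _, ?_, ?_, ?_⟩
    · rintro g ⟨p | p, q⟩ <;> rfl
    · rintro ⟨p | p, q⟩ <;> rfl
    · rintro ⟨p | p, q⟩ <;> rfl

lemma zero_extProd (X Y : Lindner O) : extProd (0 : pt ⟶ X) Y = 0 :=
  sound ⟨⟨fun p => PEmpty.elim p.1, fun p => PEmpty.elim p, fun p => PEmpty.elim p.1,
    fun p => PEmpty.elim p⟩, fun _ p => PEmpty.elim p.1, fun p => PEmpty.elim p.1,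
    fun p => PEmpty.elim p.1⟩

lemma extProd_natural {X X' Y Y' : Lindner O} (s : pt ⟶ X) (f : X ⟶ X') (g : Y ⟶ Y') :
    g ≫ extProd (s ≫ f) Y' = extProd s Y ≫ tensMap f g := by
  induction s using ind with
  | h s =>
  induction f using ind with
  | h f =>
  induction g using ind with
  | h g =>
    exact sound ⟨⟨fun p => ⟨((p.1.2.1.1.1, g.left p.1.1), (p.1.2.1.1.2, p.1.1)),
          Prod.ext p.1.2.1.2 rfl⟩,
        fun p => ⟨(p.1.2.2, (⟨(p.1.1.1, p.1.2.1), congrArg Prod.fst p.2⟩, g.right p.1.2.2)), rfl⟩,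
        fun p => Subtype.ext (Prod.ext rfl (Prod.ext rfl p.2)),
        fun p => Subtype.ext (Prod.ext (Prod.ext rfl (congrArg Prod.snd p.2).symm) rfl)⟩,
      fun a p => Subtype.ext (Prod.ext (Prod.ext rfl (map_smul g.left a p.1.1)) rfl),
      fun p => rfl, fun p => Prod.ext rfl p.2⟩

lemma pair_extProd {X Y : Lindner O} (s : pt ⟶ X) (t : pt ⟶ Y) (Z : Lindner O) :
    extProd (pair s t) Z ≫ assoc X Y Z = extProd t Z ≫ extProd s (Y.tens Z) := by
  induction s using ind with
  | h s =>
  induction t using ind with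
  | h t =>
    exact sound ⟨⟨fun p => ⟨((p.1.1.1.2, p.1.1.2), (p.1.1.1.1, (t.right p.1.1.1.2, p.1.1.2))), rfl⟩,
        fun p => ⟨(((p.1.2.1, p.1.1.1), p.1.1.2),
          ((s.right p.1.2.1, t.right p.1.1.1), p.1.1.2)), rfl⟩,
        fun p => Subtype.ext (Prod.ext rfl p.2),
        fun p => Subtype.ext (Prod.ext rfl (Prod.ext rfl p.2))⟩,
      fun a p => Subtype.ext (Prod.ext rfl (Prod.ext rfl
        (Prod.ext (map_smul t.right a p.1.1.1.2) rfl))),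
      fun p => rfl,
      fun p => congrArg (fun q : (X.set × Y.set) × Z.set => (q.1.1, (q.1.2, q.2))) p.2⟩

lemma extProd_id_lunit (X : Lindner O) : extProd (𝟙 pt) X ≫ lunit X = 𝟙 X :=
  sound ⟨⟨fun p => p.1.1.2, fun x => ⟨((PUnit.unit, x), (PUnit.unit, x)), rfl⟩,
      fun p => Subtype.ext (Prod.ext rfl p.2), fun _ => rfl⟩,
    fun _ _ => rfl, fun _ => rfl, fun p => congrArg Prod.snd p.2⟩

lemma lunit_extProd_id (X : Lindner O) : lunit X ≫ extProd (𝟙 pt) X = 𝟙 (pt.tens X) :=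
  sound ⟨⟨fun p => p.1.2, fun x => ⟨(x, x), rfl⟩,
      fun p => Subtype.ext (Prod.ext (Prod.ext rfl p.2.symm) rfl), fun _ => rfl⟩,
    fun _ _ => rfl, fun p => Prod.ext rfl p.2.symm, fun _ => rfl⟩

end Lindner

section BurnsideAction

variable {G : Type u} [Group G] {O : TransferSystem G}

open Lindner RatBurnside

/-- Multiplication with elements of `A^O_ℚ(X)`: the class of `U → X` acts through the span
`Y ← U × Y → X × Y`. -/
noncomputable def burnsideSMul (M : RatMackey.{u, v} O) (X Y : Lindner O) :
    RatBurnside X →ₗ[ℚ] M.obj.obj Y →ₗ[ℚ] M.obj.obj (X.tens Y) :=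
  RatBurnside.lift
    { toFun := fun s => (M.obj.map (extProd s Y)).hom
      map_zero' := by
        rw [zero_extProd, map_zero_of_preservesFiniteProducts M.obj M.property]; rfl
      map_add' := fun s t => by
        rw [add_extProd, map_add_of_preservesFiniteProducts M.obj M.property]; rfl }

lemma burnsideSMul_gen (M : RatMackey.{u, v} O) {X Y : Lindner O} (s : pt ⟶ X)
    (m : M.obj.obj Y) : burnsideSMul M X Y (gen s) m = M.obj.map (extProd s Y) m := by
  rw [burnsideSMul, lift_gen]; rfl

/-- The action of the Burnside functor on a Mackey functor. -/
noncomputable def burnsideAction (M : RatMackey.{u, v} O) :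
    GreenAction (burnside O) M.obj where
  smul := burnsideSMul M
  smul_natural {X X' Y Y'} f g a m := by
    change burnsideSMul M X' Y' (RatBurnside.map f a) (M.obj.map g m) =
      M.obj.map (tensMap f g) (burnsideSMul M X Y a m)
    induction a using RatBurnside.induction with
    | hadd a a' ha ha' => simp only [map_add, LinearMap.add_apply, ha, ha']
    | hsmul c a ha => simp only [map_smul, LinearMap.smul_apply, ha]
    | hgen s =>
      rw [map_gen, burnsideSMul_gen, burnsideSMul_gen, ← ConcreteCategory.comp_apply,
        ← ConcreteCategory.comp_apply, ← M.obj.map_comp, ← M.obj.map_comp, extProd_natural]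
  mul_smul {X Y Z} a b m := by
    change M.obj.map (assoc X Y Z) (burnsideSMul M (X.tens Y) Z (RatBurnside.mul X Y a b) m) =
      burnsideSMul M X (Y.tens Z) a (burnsideSMul M Y Z b m)
    change RatBurnside X at a
    change RatBurnside Y at b
    induction a using RatBurnside.induction with
    | hadd a a' ha ha' => simp only [map_add, LinearMap.add_apply, ha, ha']
    | hsmul c a ha => simp only [map_smul, LinearMap.smul_apply, ha]
    | hgen s =>
    induction b using RatBurnside.induction with
    | hadd b b' hb hb' => simp only [map_add, LinearMap.add_apply, hb, hb']
    | hsmul c b hb => simp only [map_smul, LinearMap.smul_apply, hb]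
    | hgen t =>
      rw [mul_gen, burnsideSMul_gen, burnsideSMul_gen, burnsideSMul_gen,
        ← ConcreteCategory.comp_apply, ← ConcreteCategory.comp_apply, ← M.obj.map_comp,
        ← M.obj.map_comp, pair_extProd]
  one_smul {X} m := by
    change M.obj.map (lunit X) (burnsideSMul M pt X (gen (𝟙 pt)) m) = m
    rw [burnsideSMul_gen, ← ConcreteCategory.comp_apply, ← M.obj.map_comp, extProd_id_lunit,
      M.obj.map_id]
    rfl

/-- Every action of the Burnside functor is given on generators by exterior products: unitality
determines the action of `1 ∈ A(G/G)`, and naturality that of `gen s = s_* 1`. -/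
lemma burnside_smul_gen {M : Lindner O ⥤ ModuleCat.{v} ℚ} (σ : GreenAction (burnside O) M)
    {X Y : Lindner O} (s : pt ⟶ X) (m : M.obj Y) :
    σ.smul X Y (gen s : RatBurnside X) m = M.map (extProd s Y) m := by
  have h₁ : σ.smul pt Y (burnside O).one m = M.map (extProd (𝟙 pt) Y) m := by
    conv_rhs => rw [← σ.one_smul m]
    rw [← ConcreteCategory.comp_apply, ← M.map_comp, lunit_extProd_id, M.map_id]
    rfl
  have h₂ : (burnside O).functor.map s (burnside O).one = (gen s : RatBurnside X) := by
    change RatBurnside.map s (gen (𝟙 pt)) = gen s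
    rw [map_gen, Category.id_comp]
  have h₃ := σ.smul_natural s (𝟙 Y) (burnside O).one m
  rw [h₂, h₁, M.map_id, ← ConcreteCategory.comp_apply, ← M.map_comp, ← extProd_natural,
    Category.id_comp, Category.id_comp] at h₃
  exact h₃

lemma burnsideAction_unique {M : Lindner O ⥤ ModuleCat.{v} ℚ}
    (σ τ : GreenAction (burnside O) M) : σ = τ := by
  have h : σ.smul = τ.smul := by
    funext X Y
    refine RatBurnside.hom_ext fun s => LinearMap.ext fun m => ?_
    exact (burnside_smul_gen σ s m).trans (burnside_smul_gen τ s m).symm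
  cases σ
  cases τ
  cases h
  rfl

/-- Maps of Mackey functors are automatically linear over the Burnside functor. -/
lemma burnside_map_smul {M N : GreenModule.{u, v, u + 1} (burnside O)} (f : M.mackey ⟶ N.mackey)
    (X Y : Lindner O) (a : (burnside O).functor.obj X) (m : M.mackey.obj.obj Y) :
    f.hom.app (X.tens Y) (M.action.smul X Y a m) = N.action.smul X Y a (f.hom.app Y m) := by
  have h : (f.hom.app (X.tens Y)).hom ∘ₗ (M.action.smul X Y).flip m =
      (N.action.smul X Y).flip (f.hom.app Y m) := by
    refine RatBurnside.hom_ext fun s => ?_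
    refine (congrArg _ (burnside_smul_gen M.action s m)).trans
      (Eq.trans ?_ (burnside_smul_gen N.action s _).symm)
    exact NatTrans.naturality_apply f.hom (extProd s Y) m
  exact LinearMap.congr_fun h a

lemma forget_burnside_isEquivalence :
    (GreenModule.forget.{u, v, u + 1} (burnside O)).IsEquivalence where
  faithful := ⟨fun h => GreenModule.hom_ext h⟩
  full := ⟨fun f => ⟨⟨f, burnside_map_smul f⟩, rfl⟩⟩
  essSurj := ⟨fun M => ⟨⟨M, burnsideAction M⟩, ⟨Iso.refl _⟩⟩⟩

end BurnsideAction

/-! ### The table of marks -/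

section Marks

variable {G : Type u} [Group G] {O : TransferSystem G}

open Lindner RatBurnside

/-- A finite `G`-set with isotropy in `Sub^O(G)`, as an endomorphism of `G/G`. -/
def GSpan.ofIsotropy (X : FinGSet G) (hX : ∀ x : X, O.Rel (MulAction.stabilizer G x) ⊤) :
    GSpan O FinGSet.pt FinGSet.pt where
  apex := X
  left := { toFun := fun _ => PUnit.unit, map_smul' := fun _ _ => rfl }
  right := { toFun := fun _ => PUnit.unit, map_smul' := fun _ _ => rfl }
  adm := fun x => by
    convert hX x
    exact eq_top_iff.2 fun _ _ => rfl

lemma GSpan.rel_stabilizer_top (s : GSpan O FinGSet.pt FinGSet.pt) (x : s.apex) :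
    O.Rel (MulAction.stabilizer G x) ⊤ := by
  convert s.adm x
  exact (eq_top_iff.2 fun _ _ => rfl : MulAction.stabilizer G (s.right x) = ⊤).symm

lemma rel_conj_top (H : O.AdmSub) (g : G) :
    O.Rel (H.1.map (MulAut.conj g).toMonoidHom) ⊤ := by
  have h := O.conj g H.2
  rwa [Subgroup.map_top_of_surjective _ (MulAut.conj g).surjective] at h

/-- Marks depend only on the conjugacy class of the subgroup. -/
lemma fixCount_conj (K : Subgroup G) (g : G) (f : (pt : Lindner O) ⟶ pt) :
    fixCount O (K.map (MulAut.conj g).toMonoidHom) f = fixCount O K f := by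
  induction f using Lindner.ind with
  | h s =>
    refine congrArg Nat.cast (Nat.card_congr ((MulAction.toPerm g⁻¹).subtypeEquiv fun x => ?_))
    constructor
    · intro h k
      have h1 := h ⟨g * k.1 * g⁻¹, k.1, k.2, rfl⟩
      change k.1 • g⁻¹ • x = g⁻¹ • x
      change (g * k.1 * g⁻¹) • x = x at h1
      conv_rhs => rw [← h1]
      simp [← mul_smul, mul_assoc]
    · rintro h ⟨_, k, hk, rfl⟩
      have h1 : k • g⁻¹ • x = g⁻¹ • x := h ⟨k, hk⟩
      change (g * k * g⁻¹) • x = x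
      rw [mul_smul, mul_smul, h1, smul_inv_smul]

/-- A chosen representative of a conjugacy class. -/
noncomputable def classRep (c : O.ConjClass) : O.AdmSub := Quotient.out c

lemma mk_classRep (c : O.ConjClass) : (Quotient.mk O.conjSetoid (classRep c) : O.ConjClass) = c :=
  Quotient.out_eq c

lemma exists_conj_classRep (H : O.AdmSub) : ∃ g : G, H.1.map (MulAut.conj g).toMonoidHom =
    (classRep (Quotient.mk O.conjSetoid H : O.ConjClass)).1 :=
  Quotient.exact (s := O.conjSetoid) (mk_classRep (Quotient.mk O.conjSetoid H)).symm

/-- The class of an admissible `G`-set over `X`, as an element of the Burnside functor. -/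
noncomputable def burnsideGen {X : Lindner O} : (pt ⟶ X) →+ (burnside O).functor.obj X := gen

lemma burnside_induction {X : Lindner O} {p : (burnside O).functor.obj X → Prop}
    (hgen : ∀ f, p (burnsideGen f)) (hadd : ∀ a b, p a → p b → p (a + b))
    (hsmul : ∀ (c : ℚ) a, p a → p (c • a)) (a : (burnside O).functor.obj X) : p a :=
  RatBurnside.induction hgen hadd hsmul a

lemma ghost_burnsideGen (f : (pt : Lindner O) ⟶ pt) (K : O.AdmSub) :
    ghost O (burnsideGen f) K = fixCount O K.1 f :=
  lift_gen (fixCountHom O K.1) f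

/-- Multiplication of generators of the ring `A^O_ℚ(G/G)`. -/
lemma burnside_act_burnsideGen (s t : (pt : Lindner O) ⟶ pt) :
    (burnside O).selfAction.act (burnsideGen s) pt (burnsideGen t) =
      burnsideGen (pair s t ≫ lunit pt) := by
  change RatBurnside.map (lunit pt) (RatBurnside.mul pt pt (gen s) (gen t)) = gen _
  rw [mul_gen, map_gen]

lemma fixCount_pair (K : Subgroup G) (s t : (pt : Lindner O) ⟶ pt) :
    fixCount O K (pair s t ≫ lunit pt) = fixCount O K s * fixCount O K t := by
  induction s using Lindner.ind with
  | h s =>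
  induction t using Lindner.ind with
  | h t =>
    refine Eq.trans (congrArg Nat.cast ((Nat.card_congr ?_).trans (Nat.card_prod _ _)))
      (Nat.cast_mul (Nat.card (MulAction.fixedPoints K s.apex))
        (Nat.card (MulAction.fixedPoints K t.apex)))
    exact
      { toFun := fun p => (⟨p.1.1.1.1, fun k => congrArg (fun q => q.1.1.1) (p.2 k)⟩,
          ⟨p.1.1.1.2, fun k => congrArg (fun q => q.1.1.2) (p.2 k)⟩)
        invFun := fun p => ⟨⟨((p.1.1, p.2.1), (PUnit.unit, PUnit.unit)), rfl⟩, fun k =>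
          Subtype.ext (Prod.ext (Prod.ext (p.1.2 k) (p.2.2 k)) rfl)⟩
        left_inv := fun _ => rfl
        right_inv := fun _ => rfl }

/-- The ghost coordinates are multiplicative. -/
lemma ghost_act (x y : (burnside O).functor.obj pt) :
    ghost O ((burnside O).selfAction.act x pt y) = ghost O x * ghost O y := by
  have hadd (a b : (burnside O).functor.obj pt) : (burnside O).selfAction.act (a + b) pt =
      (burnside O).selfAction.act a pt + (burnside O).selfAction.act b pt := by
    rw [GreenAction.act, map_add, LinearMap.comp_add]; rfl
  have hsmul (c : ℚ) (a : (burnside O).functor.obj pt) : (burnside O).selfAction.act (c • a) pt =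
      c • (burnside O).selfAction.act a pt := by
    rw [GreenAction.act, map_smul, LinearMap.comp_smul]; rfl
  induction x using burnside_induction with
  | hadd a b ha hb => rw [hadd, LinearMap.add_apply, map_add, ha, hb, map_add, add_mul]
  | hsmul c a ha => rw [hsmul, LinearMap.smul_apply, map_smul, ha, map_smul, smul_mul_assoc]
  | hgen s =>
  induction y using burnside_induction with
  | hadd a b ha hb => rw [map_add, map_add, ha, hb, map_add, mul_add]
  | hsmul c a ha => rw [map_smul, map_smul, ha, map_smul, mul_smul_comm]
  | hgen t =>
    funext K
    rw [burnside_act_burnsideGen, ghost_burnsideGen, fixCount_pair, Pi.mul_apply,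
      ghost_burnsideGen, ghost_burnsideGen]

lemma ghost_one : ghost O (burnside O).one = 1 := by
  funext K
  refine (ghost_burnsideGen (𝟙 pt) K).trans ?_
  have h : Nat.card (MulAction.fixedPoints K.1 (FinGSet.pt : FinGSet G)) = 1 :=
    Nat.card_eq_one_iff_unique.2 ⟨⟨fun _ _ => Subtype.ext rfl⟩, ⟨⟨PUnit.unit, fun _ => rfl⟩⟩⟩
  exact (congrArg Nat.cast h).trans Nat.cast_one

/-- Ghost coordinates depend only on conjugacy classes. -/
lemma ghost_classRep (x : (burnside O).functor.obj pt) (K : O.AdmSub) :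
    ghost O x (classRep (Quotient.mk O.conjSetoid K : O.ConjClass)) = ghost O x K := by
  obtain ⟨g, hg⟩ := exists_conj_classRep K
  induction x using burnside_induction with
  | hgen f => rw [ghost_burnsideGen, ghost_burnsideGen, ← hg, fixCount_conj]
  | hadd a b ha hb => rw [map_add, Pi.add_apply, ha, hb, Pi.add_apply]
  | hsmul c a ha => rw [map_smul, Pi.smul_apply, ha, Pi.smul_apply]

/-- Ghost coordinates at the chosen representatives of the conjugacy classes. -/
noncomputable def reducedGhost :
    (burnside O).functor.obj (pt : Lindner O) →ₗ[ℚ] (O.ConjClass → ℚ) :=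
  LinearMap.funLeft ℚ ℚ classRep ∘ₗ ghost O

variable [Finite G]

/-- The orbit `G/H` as a finite `G`-set. -/
abbrev FinGSet.orbit (H : Subgroup G) : FinGSet G := ⟨G ⧸ H⟩

/-- The class of the orbit `G/H`, for `H → G` in `O`. -/
def orbitClass (H : O.AdmSub) : (pt : Lindner O) ⟶ pt :=
  Lindner.mk (S := pt) (T := pt) (GSpan.ofIsotropy (FinGSet.orbit H.1) (fun x => by
    induction x using QuotientGroup.induction_on with
    | H g =>
      have h : (g : G ⧸ H.1) = g • ((1 : G) : G ⧸ H.1) := by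
        rw [MulAction.Quotient.smul_coe, smul_eq_mul, mul_one]
      change O.Rel (MulAction.stabilizer G (g : G ⧸ H.1)) ⊤
      rw [h, MulAction.stabilizer_smul_eq_stabilizer_map_conj, MulAction.stabilizer_quotient]
      exact rel_conj_top H g))

/-- The mark of `G/H` at `K` is nonzero only if `K` is subconjugate to `H`. -/
lemma exists_le_of_fixCount_orbitClass_ne_zero {H : O.AdmSub} {K : Subgroup G}
    (h : fixCount O K (orbitClass H) ≠ 0) :
    ∃ g : G, K ≤ H.1.map (MulAut.conj g).toMonoidHom := by
  change (Nat.card (MulAction.fixedPoints K (G ⧸ H.1)) : ℚ) ≠ 0 at h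
  obtain ⟨⟨x, hx⟩⟩ := (Nat.card_ne_zero.1 (Nat.cast_ne_zero.1 h)).1
  induction x using QuotientGroup.induction_on with
  | H g =>
    refine ⟨g, fun k hk => ⟨g⁻¹ * k * g, ?_, ?_⟩⟩
    · have h1 : ((k * g : G) : G ⧸ H.1) = (g : G) := hx ⟨k, hk⟩
      have h2 := QuotientGroup.eq.1 h1.symm
      rwa [← mul_assoc] at h2
    · simp [mul_assoc]

lemma fixCount_orbitClass_self_ne_zero (H : O.AdmSub) : fixCount O H.1 (orbitClass H) ≠ 0 := by
  change (Nat.card (MulAction.fixedPoints H.1 (G ⧸ H.1)) : ℚ) ≠ 0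
  have : Nonempty (MulAction.fixedPoints H.1 (G ⧸ H.1)) := by
    refine ⟨⟨((1 : G) : G ⧸ H.1), fun k => ?_⟩⟩
    change ((k.1 * 1 : G) : G ⧸ H.1) = (1 : G)
    rw [mul_one]
    exact QuotientGroup.eq.2 (by simp [k.2])
  exact Nat.cast_ne_zero.2 Nat.card_pos.ne'

/-- The complement of the orbit of a point. -/
def FinGSet.orbitCompl (X : FinGSet G) (x : X) : FinGSet G where
  carrier := {y : X // y ∉ MulAction.orbit G x}
  action :=
    { smul := fun g y => ⟨g • y.1, fun h => y.2 (by
        simpa using MulAction.mem_orbit_of_mem_orbit g⁻¹ h)⟩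
      one_smul := fun y => Subtype.ext (one_smul G y.1)
      mul_smul := fun g h y => Subtype.ext (mul_smul g h y.1) }

/-- A finite `G`-set splits as an orbit `G/H` and its complement. -/
lemma exists_eq_orbitClass_add (s : GSpan O FinGSet.pt FinGSet.pt) (x : s.apex) (H : O.AdmSub)
    (hx : MulAction.stabilizer G x = H.1) :
    ∃ t : GSpan O FinGSet.pt FinGSet.pt, Nat.card t.apex < Nat.card s.apex ∧
      Lindner.mk (S := pt) (T := pt) s = orbitClass H + Lindner.mk (S := pt) (T := pt) t := by
  obtain ⟨H, hH⟩ := H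
  obtain rfl : MulAction.stabilizer G x = H := hx
  let Y : FinGSet G := FinGSet.orbitCompl s.apex x
  have hY (y : Y) : O.Rel (MulAction.stabilizer G y) ⊤ := by
    convert s.rel_stabilizer_top y.1
    ext g
    exact Subtype.ext_iff
  refine ⟨GSpan.ofIsotropy Y hY, ?_, Eq.symm ?_⟩
  · exact Finite.card_subtype_lt (x := x) (not_not.2 (MulAction.mem_orbit_self x))
  refine sound ⟨Equiv.ofBijective
    (Sum.elim (MulAction.ofQuotientStabilizer G x) (fun y : Y => y.1)) ⟨?_, ?_⟩, ?_,
    fun _ => rfl, fun _ => rfl⟩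
  · rintro (a | a) (b | b) h
    · exact congrArg Sum.inl (MulAction.injective_ofQuotientStabilizer G x h)
    · have h' : MulAction.ofQuotientStabilizer G x a = b.1 := h
      exact (b.2 (h' ▸ MulAction.ofQuotientStabilizer_mem_orbit G x a)).elim
    · have h' : a.1 = MulAction.ofQuotientStabilizer G x b := h
      exact (a.2 (h' ▸ MulAction.ofQuotientStabilizer_mem_orbit G x b)).elim
    · exact congrArg Sum.inr (Subtype.ext h)
  · intro y
    by_cases hy : y ∈ MulAction.orbit G x
    · obtain ⟨g, rfl⟩ := hy
      exact ⟨Sum.inl (g : G ⧸ MulAction.stabilizer G x), rfl⟩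
    · exact ⟨Sum.inr ⟨y, hy⟩, rfl⟩
  · rintro g (a | a)
    · exact MulAction.ofQuotientStabilizer_smul G x g a
    · rfl

lemma gen_mem_span_orbitClass (f : (pt : Lindner O) ⟶ pt) :
    (burnsideGen f) ∈
      Submodule.span ℚ (Set.range fun c : O.ConjClass =>
        burnsideGen (orbitClass (classRep c))) := by
  induction f using Lindner.ind with
  | h s =>
  induction hn : Nat.card s.apex using Nat.strong_induction_on generalizing s with
  | h n ih =>
  rcases isEmpty_or_nonempty s.apex with hs | ⟨⟨x⟩⟩
  · have h : Lindner.mk (S := pt) (T := pt) s = 0 :=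
      sound ⟨(Equiv.equivPEmpty s.apex), fun _ y => hs.elim y, fun y => hs.elim y,
        fun y => hs.elim y⟩
    rw [h, map_zero]
    exact Submodule.zero_mem _
  · -- the point `x` can be moved in its orbit so that its isotropy is a chosen representative
    obtain ⟨g, hg⟩ := exists_conj_classRep (⟨_, s.rel_stabilizer_top x⟩ : O.AdmSub)
    obtain ⟨t, ht, h⟩ := exists_eq_orbitClass_add s (g • x) _
      ((MulAction.stabilizer_smul_eq_stabilizer_map_conj g x).trans hg)
    rw [h, map_add]
    exact Submodule.add_mem _ (Submodule.subset_span ⟨_, rfl⟩) (ih _ (hn ▸ ht) t rfl)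

instance : Finite O.AdmSub := inferInstanceAs (Finite {H : Subgroup G // O.Rel H ⊤})

instance : Finite O.ConjClass := inferInstanceAs (Finite (Quotient O.conjSetoid))

/-- The table of marks is invertible: for the order on classes given by the cardinality of the
subgroups it is triangular with nonzero diagonal, so a linear combination of orbits
whose marks all vanish has no orbit `G/H` of maximal `|H|`. -/
lemma eq_zero_of_reducedGhost_sum [Fintype O.ConjClass] (a : O.ConjClass → ℚ)
    (h : reducedGhost (∑ c, a c • burnsideGen (orbitClass (classRep c))) = 0) : a = 0 := by
  classical
  by_contra ha
  obtain ⟨d, hd⟩ := Function.ne_iff.1 ha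
  obtain ⟨c, hc, hmax⟩ := Finset.exists_max_image (Finset.univ.filter fun c => a c ≠ 0)
    (fun c => Nat.card (classRep c).1) ⟨d, by simpa using hd⟩
  have hc0 : a c ≠ 0 := (Finset.mem_filter.1 hc).2
  have h1 : ∑ d, a d * fixCount O (classRep c).1 (orbitClass (classRep d)) = 0 := by
    have h2 : ghost O (∑ d, a d • burnsideGen (orbitClass (classRep d))) (classRep c) = 0 :=
      congrFun h c
    simpa only [map_sum, map_smul, Finset.sum_apply, Pi.smul_apply, ghost_burnsideGen,
      smul_eq_mul] using h2
  rw [Finset.sum_eq_single c] at h1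
  · exact mul_ne_zero hc0 (fixCount_orbitClass_self_ne_zero _) h1
  · intro d _ hdc
    by_contra hne
    have had := left_ne_zero_of_mul hne
    obtain ⟨g, hg⟩ := exists_le_of_fixCount_orbitClass_ne_zero (right_ne_zero_of_mul hne)
    refine hdc ?_
    have hcard : Nat.card ((classRep d).1.map (MulAut.conj g).toMonoidHom) =
        Nat.card (classRep d).1 :=
      Subgroup.card_map_of_injective (MulAut.conj g).injective
    have heq := Subgroup.eq_of_le_of_card_ge hg
      (hcard.trans_le (hmax d (Finset.mem_filter.2 ⟨Finset.mem_univ _, had⟩)))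
    rw [← mk_classRep d, ← mk_classRep c]
    exact Quotient.sound (s := O.conjSetoid) ⟨g, heq.symm⟩
  · simp

/-- The linear extension of the marks identifies `A^O_ℚ(G/G)` with the functions on
`Sub^O(G)/G`. -/
lemma reducedGhost_bijective : Function.Bijective (reducedGhost (O := O)) := by
  have := Fintype.ofFinite O.ConjClass
  let b : O.ConjClass → (burnside O).functor.obj (pt : Lindner O) :=
    fun c => burnsideGen (orbitClass (classRep c))
  let Ψ := Fintype.linearCombination ℚ b
  have hspan : Submodule.span ℚ (Set.range b) = ⊤ := by
    refine eq_top_iff.2 fun x _ => ?_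
    induction x using burnside_induction with
    | hgen f => exact gen_mem_span_orbitClass f
    | hadd a b ha hb => exact Submodule.add_mem _ (ha trivial) (hb trivial)
    | hsmul c a ha => exact Submodule.smul_mem _ c (ha trivial)
  have hΨ : Function.Surjective Ψ := by
    rw [← LinearMap.range_eq_top, Fintype.range_linearCombination, hspan]
  have hinj : Function.Injective (reducedGhost ∘ₗ Ψ) :=
    (injective_iff_map_eq_zero _).2 fun a ha => eq_zero_of_reducedGhost_sum a ha
  have hsurj : Function.Surjective (reducedGhost ∘ₗ Ψ) :=
    LinearMap.injective_iff_surjective.1 hinj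
  refine ⟨fun x y hxy => ?_, fun y => ?_⟩
  · obtain ⟨a, rfl⟩ := hΨ x
    obtain ⟨b, rfl⟩ := hΨ y
    exact congrArg Ψ (hinj hxy)
  · obtain ⟨a, ha⟩ := hsurj y
    exact ⟨Ψ a, ha⟩

lemma ghost_injective : Function.Injective (ghost O) := fun _ _ h =>
  reducedGhost_bijective.1 (congrArg (LinearMap.funLeft ℚ ℚ classRep) h)

lemma exists_ghost_eq_delta (c : O.ConjClass) : ∃ x, ghost O x = delta O c := by
  classical
  obtain ⟨x, hx⟩ := reducedGhost_bijective.2 (fun d => if d = c then 1 else 0)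
  refine ⟨x, funext fun K => ?_⟩
  rw [← ghost_classRep]
  exact (congrFun hx (Quotient.mk O.conjSetoid K)).trans (if_congr Iff.rfl rfl rfl)

end Marks

/-! ### Splitting modules along orthogonal idempotents -/

lemma ratMackey_hom_ext {G : Type u} [Group G] {O : TransferSystem G} {M N : RatMackey.{u, v} O}
    {f g : M ⟶ N} (h : ∀ (X : Lindner O) (m : M.obj.obj X), f.hom.app X m = g.hom.app X m) :
    f = g :=
  InducedCategory.hom_ext (NatTrans.ext (funext fun X =>
    ModuleCat.hom_ext (LinearMap.ext (h X))))

lemma sum_hom_app_apply {G : Type u} [Group G] {O : TransferSystem G} {M N : RatMackey.{u, v} O}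
    {C : Type*} [Fintype C] (f : C → (M ⟶ N)) (X : Lindner O) (m : M.obj.obj X) :
    (∑ c, f c).hom.app X m = ∑ c, (f c).hom.app X m :=
  map_sum (⟨⟨fun f => (f.hom.app X).hom m, rfl⟩, fun _ _ => rfl⟩ : (M ⟶ N) →+ N.obj.obj X) _ _

lemma GreenModule.hom_ext_apply {G : Type u} [Group G] {O : TransferSystem G}
    {A : GreenFunctor.{u, w} O} {M N : GreenModule.{u, v, w} A} {f g : M ⟶ N}
    (h : ∀ (X : Lindner O) (m : M.mackey.obj.obj X), f.hom.hom.app X m = g.hom.hom.app X m) :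
    f = g :=
  GreenModule.hom_ext (ratMackey_hom_ext h)

namespace GreenAction

open Lindner

variable {G : Type u} [Group G] {O : TransferSystem G} {A : GreenFunctor.{u, w} O}
  {M : Lindner O ⥤ ModuleCat.{v} ℚ} (σ : GreenAction A M)

lemma act_zero (X : Lindner O) : σ.act 0 X = 0 := by
  rw [act, map_zero, LinearMap.comp_zero]

lemma act_sum {ι : Type*} (s : Finset ι) (a : ι → A.functor.obj pt) (X : Lindner O) (m : M.obj X) :
    σ.act (∑ i ∈ s, a i) X m = ∑ i ∈ s, σ.act (a i) X m := by
  simp only [act, map_sum, LinearMap.comp_apply, LinearMap.sum_apply]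

lemma act_one (X : Lindner O) (m : M.obj X) : σ.act A.one X m = m := σ.one_smul m

/-- Multiplication with an idempotent is multiplicative. -/
lemma act_smul_act (e : A.Idem) {X Y : Lindner O} (a : A.functor.obj X) (m : M.obj Y) :
    σ.smul X Y (A.selfAction.act e.1 X a) (σ.act e.1 Y m) =
      σ.act e.1 (X.tens Y) (σ.smul X Y a m) := by
  rw [smul_act, ← act_smul, act_idem]

end GreenAction

namespace GreenFunctor

variable {G : Type u} [Group G] {O : TransferSystem G} (A : GreenFunctor.{u, w} O)

lemma toPiece_coe (e : A.Idem) {X : Lindner O} (a : (A.piece e).functor.obj X) :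
    A.toPiece e X a.1 = a :=
  Subtype.ext ((A.selfAction.mem_range_act e).1 a.2)

/-- A finite family of pairwise orthogonal idempotents with sum `1`. -/
structure CompleteOrthogonal {C : Type*} [Fintype C] (e : C → A.Idem) : Prop where
  orthogonal : ∀ c d, c ≠ d → A.selfAction.act (e c).1 Lindner.pt (e d).1 = 0
  sum_eq_one : ∑ c, (e c).1 = A.one

end GreenFunctor

namespace GreenFunctor.CompleteOrthogonal

variable {G : Type u} [Group G] {O : TransferSystem G} {A : GreenFunctor.{u, w} O}
  {C : Type u} [Fintype C] {e : C → A.Idem}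

lemma sum_act (he : A.CompleteOrthogonal e) {M : Lindner O ⥤ ModuleCat.{v} ℚ}
    (σ : GreenAction A M) {X : Lindner O} (m : M.obj X) : ∑ c, σ.act (e c).1 X m = m := by
  rw [← σ.act_sum, he.sum_eq_one, σ.act_one]

lemma act_act_of_ne (he : A.CompleteOrthogonal e) {M : Lindner O ⥤ ModuleCat.{v} ℚ}
    (σ : GreenAction A M) {X : Lindner O} {c d : C} (h : c ≠ d) (m : M.obj X) :
    σ.act (e c).1 X (σ.act (e d).1 X m) = 0 := by
  rw [σ.act_act, he.orthogonal c d h, σ.act_zero]; rfl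

/-- The pieces of a Mackey functor form a biproduct. -/
def isBilimitPieces [DecidableEq C] (he : A.CompleteOrthogonal e) {M : RatMackey.{u, v} O}
    (σ : GreenAction A M.obj) :
    ({ pt := M
       ι := fun c => σ.mackeyIncl (e c)
       π := fun c => σ.mackeyProj (e c)
       ι_π := fun c d => by
        split_ifs with h
        · subst h
          exact InducedCategory.hom_ext (σ.pieceIncl_proj (e c))
        · refine ratMackey_hom_ext fun X m => Subtype.ext ?_
          obtain ⟨_, m, rfl⟩ := m
          exact he.act_act_of_ne σ (Ne.symm h) m } : Bicone fun c => σ.mackeyPiece (e c)).IsBilimit :=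
  isBilimitOfTotal _ <| by
    refine ratMackey_hom_ext fun X m => ?_
    refine Eq.trans ?_ (he.sum_act σ m)
    exact sum_hom_app_apply _ X m

end GreenFunctor.CompleteOrthogonal

namespace GreenModule

open Lindner

variable {G : Type u} [Group G] {O : TransferSystem G} {A : GreenFunctor.{u, w} O}

/-- Restriction of scalars to `A` along `A → e A` is fully faithful. -/
def restrictScalarsFullyFaithful (e : A.Idem) :
    (restrictScalars.{u, v, w} (A := A) e).FullyFaithful where
  preimage {M N} f :=
    { hom := f.hom
      map_smul := fun X Y a m => by
        have h := f.map_smul X Y a.1 m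
        change f.hom.hom.app _ (M.action.smul X Y (A.toPiece e X a.1) m) =
          N.action.smul X Y (A.toPiece e X a.1) (f.hom.hom.app Y m) at h
        rwa [A.toPiece_coe] at h }

/-- On an `e A`-module, viewed as an `A`-module, an element `x ∈ A(G/G)` acts through `e x`. -/
lemma restrictScalars_act {e : A.Idem} (N : GreenModule.{u, v, w} (A.piece e))
    (x : A.functor.obj pt) {X : Lindner O} (n : N.mackey.obj.obj X) :
    ((restrictScalars e).obj N).action.act x X n = N.action.act (A.toPiece e pt x) X n := rfl

lemma restrictScalars_act_self {e : A.Idem} (N : GreenModule.{u, v, w} (A.piece e))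
    {X : Lindner O} (n : N.mackey.obj.obj X) :
    ((restrictScalars e).obj N).action.act e.1 X n = n := by
  have h : A.toPiece e pt e.1 = (A.piece e).one := Subtype.ext e.2
  rw [restrictScalars_act, h]
  exact N.action.one_smul n

lemma restrictScalars_act_of_orthogonal {e d : A.Idem}
    (h : A.selfAction.act e.1 pt d.1 = 0) (N : GreenModule.{u, v, w} (A.piece e))
    {X : Lindner O} (n : N.mackey.obj.obj X) :
    ((restrictScalars e).obj N).action.act d.1 X n = 0 := by
  have h : A.toPiece e pt d.1 = 0 := Subtype.ext h
  rw [restrictScalars_act, h]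
  exact LinearMap.congr_fun (N.action.act_zero X) n

/-- Modules over orthogonal pieces have no nonzero maps between them: such a map commutes with
an idempotent that is the identity on the source and zero on the target. -/
lemma subsingleton_restrictScalars_hom {e d : A.Idem}
    (h : A.selfAction.act d.1 pt e.1 = 0) (M : GreenModule.{u, v, w} (A.piece e))
    (N : GreenModule.{u, v, w} (A.piece d)) :
    Subsingleton ((restrictScalars e).obj M ⟶ (restrictScalars d).obj N) := by
  have hz (f : (restrictScalars e).obj M ⟶ (restrictScalars d).obj N) (X : Lindner O)
      (m : M.mackey.obj.obj X) : f.hom.hom.app X m = 0 := by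
    have h1 := map_act f e.1 (X := X) m
    exact (congrArg (f.hom.hom.app X) (restrictScalars_act_self M m)).symm.trans
      (h1.trans (restrictScalars_act_of_orthogonal h N (f.hom.hom.app X m)))
  exact ⟨fun f g => hom_ext_apply fun X m => (hz f X m).trans (hz g X m).symm⟩

/-- The inclusion `e M → M` as a map of `A`-modules. -/
def incl (e : A.Idem) (M : GreenModule.{u, v, w} A) : (restrictScalars e).obj (M.piece e) ⟶ M where
  hom := M.action.mackeyIncl e
  map_smul X Y a m := by
    obtain ⟨_, m, rfl⟩ := m
    exact (M.action.act_smul_act e a m).trans (M.action.smul_act e.1 a m).symm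

/-- The projection `M → e M` as a map of `A`-modules. -/
def proj (e : A.Idem) (M : GreenModule.{u, v, w} A) : M ⟶ (restrictScalars e).obj (M.piece e) where
  hom := M.action.mackeyProj e
  map_smul _ _ a m := Subtype.ext (M.action.act_smul_act e a m).symm

/-- The sum of finitely many maps of modules. -/
def sumHom {C : Type*} [Fintype C] {M N : GreenModule.{u, v, w} A} (f : C → (M ⟶ N)) : M ⟶ N where
  hom := ∑ c, (f c).hom
  map_smul X Y a m := by
    rw [sum_hom_app_apply, sum_hom_app_apply, map_sum]
    exact Finset.sum_congr rfl fun c _ => (f c).map_smul X Y a m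

/-- An `e A`-module is recovered from its restriction of scalars as the piece of `e`. -/
def pieceRestrictScalarsIso (e : A.Idem) (N : GreenModule.{u, v, w} (A.piece e)) :
    (pieceFunctor e).obj ((restrictScalars e).obj N) ≅ N where
  hom :=
    { hom := ((restrictScalars e).obj N).action.mackeyIncl e
      map_smul := fun X Y a m => by
        change N.action.smul X Y (A.toPiece e X a.1) m.1 = N.action.smul X Y a m.1
        rw [A.toPiece_coe] }
  inv :=
    { hom := ((restrictScalars e).obj N).action.mackeyProj e
      map_smul := fun X Y a n => by
        refine Subtype.ext ((restrictScalars_act_self N _).trans ?_)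
        change N.action.smul X Y a n = N.action.smul X Y (A.toPiece e X a.1) _
        rw [A.toPiece_coe]
        exact congrArg (N.action.smul X Y a) (restrictScalars_act_self N n).symm }
  hom_inv_id := hom_ext (ObjectProperty.hom_ext _
    (((restrictScalars e).obj N).action.pieceIncl_proj e))
  inv_hom_id := hom_ext_apply fun X n => restrictScalars_act_self N n

/-- The product of finitely many modules. The index type is `Fin n`, so that the product does not
raise the universe level of the modules. -/
def pi {n : ℕ} (R : Fin n → GreenModule.{u, v, w} A) : GreenModule.{u, v, w} A where
  mackey :=
    { obj :=
        { obj := fun X => ModuleCat.of ℚ (∀ i, (R i).mackey.obj.obj X)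
          map := fun f => ModuleCat.ofHom
            (LinearMap.pi fun i => ((R i).mackey.obj.map f).hom ∘ₗ LinearMap.proj i)
          map_id := fun X => ModuleCat.hom_ext (LinearMap.ext fun m => funext fun i =>
            ConcreteCategory.congr_hom ((R i).mackey.obj.map_id X) (m i))
          map_comp := fun f g => ModuleCat.hom_ext (LinearMap.ext fun m => funext fun i =>
            ConcreteCategory.congr_hom ((R i).mackey.obj.map_comp f g) (m i)) }
      property := preservesFiniteProducts_of_additive _
        (fun f g => ModuleCat.hom_ext (LinearMap.ext fun m => funext fun i =>
          ConcreteCategory.congr_hom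
            (map_add_of_preservesFiniteProducts _ (R i).mackey.property f g) (m i)))
        (fun X Y => ModuleCat.hom_ext (LinearMap.ext fun m => funext fun i =>
          ConcreteCategory.congr_hom
            (map_zero_of_preservesFiniteProducts _ (R i).mackey.property X Y) (m i))) }
  action :=
    { smul := fun X Y => LinearMap.mk₂ ℚ (fun a m i => (R i).action.smul X Y a (m i))
        (fun _ _ _ => funext fun _ => LinearMap.map_add₂ _ _ _ _)
        (fun _ _ _ => funext fun _ => LinearMap.map_smul₂ _ _ _ _)
        (fun _ _ _ => funext fun _ => map_add _ _ _)
        (fun _ _ _ => funext fun _ => map_smul _ _ _)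
      smul_natural := fun f g a m => funext fun i => (R i).action.smul_natural f g a (m i)
      mul_smul := fun a b m => funext fun i => (R i).action.mul_smul a b (m i)
      one_smul := fun m => funext fun i => (R i).action.one_smul (m i) }

/-- The projections from a product of modules. -/
def piProj {n : ℕ} (R : Fin n → GreenModule.{u, v, w} A) (i : Fin n) : pi R ⟶ R i where
  hom := ObjectProperty.homMk { app := fun X => ModuleCat.ofHom (LinearMap.proj i) }
  map_smul _ _ _ _ := rfl

/-- The inclusions into a product of modules. -/
def piSingle {n : ℕ} (R : Fin n → GreenModule.{u, v, w} A) (i : Fin n) : R i ⟶ pi R where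
  hom := ObjectProperty.homMk
    { app := fun X => ModuleCat.ofHom (LinearMap.single ℚ (fun i => (R i).mackey.obj.obj X) i)
      naturality := fun _ _ f => ModuleCat.hom_ext (LinearMap.ext fun m => funext fun j => by
        exact (Pi.apply_single (fun j => ((R j).mackey.obj.map f).hom) (fun _ => map_zero _)
          i m j).symm) }
  map_smul X Y a m := funext fun j =>
    (Pi.apply_single (fun j => (R j).action.smul X Y a) (fun _ => map_zero _) i m j).symm

/-- Finite families of modules have biproducts. -/
lemma exists_biproduct {C : Type*} [Fintype C] (R : C → GreenModule.{u, v, w} A) :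
    ∃ (M : GreenModule.{u, v, w} A) (π : ∀ c, M ⟶ R c) (ι : ∀ c, R c ⟶ M),
      (∀ c, ι c ≫ π c = 𝟙 _) ∧ sumHom (fun c => π c ≫ ι c) = 𝟙 M := by
  let ε := Fintype.equivFin C
  let R' : Fin (Fintype.card C) → GreenModule.{u, v, w} A := fun i => R (ε.symm i)
  have h (c : C) : R' (ε c) = R c := congrArg R (ε.symm_apply_apply c)
  refine ⟨pi R', fun c => piProj R' (ε c) ≫ eqToHom (h c),
    fun c => eqToHom (h c).symm ≫ piSingle R' (ε c), fun c => ?_, ?_⟩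
  · have h1 : piSingle R' (ε c) ≫ piProj R' (ε c) = 𝟙 _ :=
      hom_ext_apply fun X m => Pi.single_eq_same _ _
    rw [Category.assoc, ← Category.assoc (piSingle _ _), h1, Category.id_comp, eqToHom_trans,
      eqToHom_refl]
  · refine hom_ext_apply fun X m => (sum_hom_app_apply _ X m).trans ?_
    simp only [Category.assoc, eqToHom_trans_assoc, eqToHom_refl, Category.id_comp]
    refine (Equiv.sum_comp ε fun i =>
      (piProj R' i ≫ piSingle R' i).hom.hom.app X m).trans ?_
    exact LinearMap.sum_single_apply _ m

end GreenModule

namespace GreenFunctor.CompleteOrthogonal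

variable {G : Type u} [Group G] {O : TransferSystem G} {A : GreenFunctor.{u, w} O}
  {C : Type u} [Fintype C] {e : C → A.Idem}

open GreenModule

lemma splitting_faithful (he : A.CompleteOrthogonal e) : (splitting.{u, v, w} e).Faithful where
  map_injective {M N f g} h := by
    refine hom_ext_apply fun X m => ?_
    rw [← he.sum_act M.action m, map_sum, map_sum]
    refine Finset.sum_congr rfl fun c _ => ?_
    exact congrArg (fun k : (splitting e).obj M ⟶ (splitting e).obj N =>
      ((k c).hom.hom.app X ⟨M.action.act (e c).1 X m, ⟨m, rfl⟩⟩).1) h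

lemma splitting_full (he : A.CompleteOrthogonal e) : (splitting.{u, v, w} e).Full where
  map_surjective {M N} f := by
    classical
    refine ⟨sumHom fun c => proj (e c) M ≫ (restrictScalars (e c)).map (f c) ≫ incl (e c) N,
      funext fun c => hom_ext_apply fun X m => Subtype.ext ?_⟩
    refine (sum_hom_app_apply _ X _).trans ((Finset.sum_eq_single c ?_ ?_).trans ?_)
    · intro d _ hdc
      have h : (proj (e d) M).hom.hom.app X m.1 = 0 := by
        obtain ⟨_, m, rfl⟩ := m
        exact Subtype.ext (he.act_act_of_ne M.action hdc m)
      change ((f d).hom.hom.app X ((proj (e d) M).hom.hom.app X m.1)).1 = 0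
      exact congrArg Subtype.val ((congrArg ((f d).hom.hom.app X) h).trans (map_zero _))
    · simp
    · have h : (proj (e c) M).hom.hom.app X m.1 = m :=
        Subtype.ext ((M.action.mem_range_act (e c)).1 m.2)
      change ((f c).hom.hom.app X ((proj (e c) M).hom.hom.app X m.1)).1 = _
      rw [h]

/-- A family of modules over the pieces is the splitting of the biproduct of the restrictions of
scalars. -/
lemma splitting_essSurj (he : A.CompleteOrthogonal e) : (splitting.{u, v, w} e).EssSurj where
  mem_essImage N := by
    classical
    obtain ⟨M, π, ι, h1, h2⟩ := exists_biproduct fun c => (restrictScalars (e c)).obj (N c)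
    have hπι (c : C) : (pieceFunctor (e c)).map (π c) ≫ (pieceFunctor (e c)).map (ι c) = 𝟙 _ := by
      refine hom_ext_apply fun X m => Subtype.ext ?_
      change (ι c).hom.hom.app X ((π c).hom.hom.app X m.1) = m.1
      have h3 : ∑ d, (ι d).hom.hom.app X ((π d).hom.hom.app X m.1) = m.1 :=
        (sum_hom_app_apply _ X m.1).symm.trans
          (congrArg (fun k : M ⟶ M => k.hom.hom.app X m.1) h2)
      rw [Finset.sum_eq_single c] at h3
      · exact h3
      · -- `e c` acts as zero on modules over the other pieces, so `π d` kills `e c · M`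
        intro d _ hdc
        have h4 : (π d).hom.hom.app X m.1 = 0 := by
          obtain ⟨_, m, rfl⟩ := m
          exact (map_act (π d) (e c).1 m).trans
            (restrictScalars_act_of_orthogonal (he.orthogonal d c hdc) (N d) _)
        rw [h4, map_zero]
      · simp
    have hιπ (c : C) : (pieceFunctor (e c)).map (ι c) ≫ (pieceFunctor (e c)).map (π c) = 𝟙 _ := by
      rw [← Functor.map_comp, h1, CategoryTheory.Functor.map_id]
    let i (c : C) : (pieceFunctor (e c)).obj M ≅ N c :=
      ⟨(pieceFunctor (e c)).map (π c), (pieceFunctor (e c)).map (ι c), hπι c, hιπ c⟩ ≪≫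
        pieceRestrictScalarsIso (e c) (N c)
    exact ⟨M, ⟨⟨fun c => (i c).hom, fun c => (i c).inv, funext fun c => (i c).hom_inv_id,
      funext fun c => (i c).inv_hom_id⟩⟩⟩

end GreenFunctor.CompleteOrthogonal

/-! ### The idempotents of the Burnside ring -/

section BurnsideIdempotents

variable {G : Type u} [Group G] (O : TransferSystem G)

open Lindner

lemma delta_mul_self (c : O.ConjClass) : delta O c * delta O c = delta O c := by
  funext K
  simp only [Pi.mul_apply, delta]
  split_ifs <;> simp

lemma delta_mul_of_ne {c d : O.ConjClass} (h : c ≠ d) : delta O c * delta O d = 0 := by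
  funext K
  simp only [Pi.mul_apply, delta, Pi.zero_apply, mul_eq_zero, ite_eq_right_iff, one_ne_zero]
  by_contra! hK
  exact h (hK.1.1.symm.trans hK.2.1)

lemma sum_delta [Fintype O.ConjClass] : ∑ c, delta O c = 1 := by
  funext K
  refine (Finset.sum_apply K _ _).trans ((Finset.sum_eq_single (ι := O.ConjClass)
    (Quotient.mk O.conjSetoid K) (fun c _ hc => if_neg hc.symm) ?_).trans (if_pos rfl))
  exact fun h => (h (Finset.mem_univ _)).elim

variable [Finite G]

/-- The idempotent `e_[H]`. -/
noncomputable def classIdem (c : O.ConjClass) : (burnside O).Idem :=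
  ⟨(exists_ghost_eq_delta c).choose, ghost_injective <| by
    rw [ghost_act, (exists_ghost_eq_delta c).choose_spec, delta_mul_self]⟩

lemma ghost_classIdem (c : O.ConjClass) : ghost O (classIdem O c).1 = delta O c :=
  (exists_ghost_eq_delta c).choose_spec

lemma completeOrthogonal_classIdem [Fintype O.ConjClass] :
    (burnside O).CompleteOrthogonal (classIdem O) where
  orthogonal c d h := ghost_injective <| by
    rw [ghost_act, ghost_classIdem, ghost_classIdem, delta_mul_of_ne O h, map_zero]
  sum_eq_one := ghost_injective <| by
    simp only [map_sum, ghost_classIdem, sum_delta, ghost_one]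

end BurnsideIdempotents

end OMackey

theorem mainTheorem1 {G : Type u} [Group G] [Finite G] (O : TransferSystem G) :
    -- the elements `e_[H]` of `A^O_ℚ(G/G)` whose ghost coordinates are the characteristic
    -- functions of the classes `(H)` exist, are unique, and are idempotent
    ∃ e : O.ConjClass → (burnside O).Idem,
      (∀ (c : O.ConjClass) (x : (burnside O).functor.obj Lindner.pt),
        ghost O x = delta O c ↔ x = (e c).1) ∧
      -- rational `O`-Mackey functors are the same as modules over `A^O_ℚ`
      (GreenModule.forget.{u, v, u + 1} (burnside O)).IsEquivalence ∧
      (∀ M : RatMackey.{u, v} O, Nonempty (Unique (GreenAction (burnside O) M.obj))) ∧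
      -- the splitting of the category of modules, `M ↦ (e_[H] M)_(H)`
      (splitting.{u, v, u + 1} e).IsEquivalence ∧
      -- the factors are orthogonal full subcategories
      (∀ c : O.ConjClass, (GreenModule.restrictScalars.{u, v, u + 1} (e c)).Full ∧
        (GreenModule.restrictScalars.{u, v, u + 1} (e c)).Faithful) ∧
      (∀ c d : O.ConjClass, c ≠ d →
        ∀ (M : GreenModule.{u, v, u + 1} ((burnside O).piece (e c)))
          (N : GreenModule.{u, v, u + 1} ((burnside O).piece (e d))),
          Subsingleton ((GreenModule.restrictScalars (e c)).obj M ⟶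
            (GreenModule.restrictScalars (e d)).obj N)) ∧
      -- every rational `O`-Mackey functor is the direct sum of its pieces `e_[H] M`
      (∀ (M : RatMackey.{u, v} O) (σ : GreenAction (burnside O) M.obj),
        Nonempty (IsColimit (Cofan.mk M fun c => σ.mackeyIncl (e c))) ∧
        Nonempty (IsLimit (Fan.mk M fun c => σ.mackeyProj (e c)))) := by
  classical
  have := Fintype.ofFinite O.ConjClass
  have he := completeOrthogonal_classIdem O
  refine ⟨classIdem O, fun c x => ?_, forget_burnside_isEquivalence,
    fun M => ⟨⟨⟨burnsideAction M⟩, fun σ => burnsideAction_unique σ _⟩⟩,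
    ⟨he.splitting_faithful, he.splitting_full, he.splitting_essSurj⟩,
    fun c => ⟨(GreenModule.restrictScalarsFullyFaithful _).full,
      (GreenModule.restrictScalarsFullyFaithful _).faithful⟩,
    fun c d h => GreenModule.subsingleton_restrictScalars_hom (he.orthogonal d c h.symm),
    fun M σ => ⟨⟨(he.isBilimitPieces σ).isColimit⟩, ⟨(he.isBilimitPieces σ).isLimit⟩⟩⟩
  rw [← ghost_classIdem]
  exact ghost_injective.eq_iff
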